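/- **Setting.** Let $K$ be a field of characteristic $0$, and let $\sigma_x,\sigma_y$ be field automorphisms of $K(x,y)$ and $\delta_x,\delta_y$ be $K$-linear maps $K(x,y)\to K(x,y)$ with $\delta_x(ab)=\delta_x(a)b+\sigma_x(a)\delta_x(b)$ and $\delta_y(ab)=\delta_y(a)b+\sigma_y(a)\delta_y(b)$, such that $\sigma_x\sigma_y=\sigma_y\sigma_x$, $\sigma_x\delta_y=\delta_y\sigma_x$, $\delta_x\sigma_y=\sigma_y\delta_x$, $\delta_x\delta_y=\delta_y\delta_x$. Assume that these four maps send $K[x,y]$ to itself and that for all $p\in K[x,y]$ (with $\deg 0=-\infty$, and with $\deg q\le -1$ meaning $q=0$) $\deg_x\sigma_x(p)=\deg_x\sigma_y(p)=\deg_x p$, $\deg_y\sigma_x(p)=\deg_y\sigma_y(p)=\deg_y p$, $\deg_x\delta_x(p)\le\deg_x p-1$, $\deg_y\delta_x(p)\le\deg_y p$, $\deg_x\delta_y(p)\le\deg_x p$, $\deg_y\delta_y(p)\le\deg_y p-1$. Let $A=K(x,y)[\partial_x,\partial_y]$ be the Ore algebra of polynomials $\sum a_{i,j}\partial_x^i\partial_y^j$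 with $a_{i,j}\in K(x,y)$ and with the multiplication determined by $\partial_x\partial_y=\partial_y\partial_x$, $\partial_x a=\sigma_x(a)\partial_x+\delta_x(a)$, $\partial_y a=\sigma_y(a)\partial_y+\delta_y(a)$. **Left borders.** For $a\in K(x,y)$ put $a^{(i,x)}=\prod_{j=0}^{i-1}\sigma_x^j(a)$ and $a^{(i,y)}=\prod_{j=0}^{i-1}\sigma_y^j(a)$. Given $p\in K(x)[y]\setminus\{0\}$, let $n$ be the largest integer such that $q^{(n,y)}$ divides $p$ in $K(x)[y]$ for some monic $q\in K(x)[y]$ with $\deg_y q>0$, take such a $q$ (for this $n$) of largest degree, replace $p$ by $p/q^{(n,y)}$, and repeat until an element of $K(x)$ remains. The product of the polynomials $q$ split off in this way is the left border $\lfloor p\rfloor_y$ of $p$. (If the choices of $q$ are not unique, then "the left border of $p$ has degree at most $d$" means that this holds for some choice.) **Proper ideals and height.** A left ideal $\mathfrak a\subseteq A$ is $\partial$-finite if $\dim_{K(x,y)}A/\mathfrak a<\infty$. A $K(x,y)$-basis $b=(b_1,\dots,b_n)^T$ of $A/\mathfrak a$ is admissible if the coordinates of $1\in A/\mathfrak a$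 lie in $K(x)[y]$. Write $\partial_x b=\frac1uUb$ and $\partial_y b=\frac1vVb$ with nonzero $u,v\in K[x,y]$ and matrices $U,V\in K[x,y]^{n\times n}$. A nonzero $u\in K[x,y]$ is $y$-proper if $\deg_y\lfloor u^{(r,x)}\rfloor_y=O(1)$ as $r\to\infty$. A $\partial$-finite left ideal $\mathfrak a$ is proper with respect to $y$ if $A/\mathfrak a$ has an admissible basis for which $u$ can be chosen $y$-proper. For an admissible basis and $u,U,v,V$ as above with $u$ $y$-proper, let $\eta\in\mathbb N$ be the smallest number such that for every $r\ge1$ there are $f_1,\dots,f_m,g,h\in K[x,y]$ and integers $p_i\ge q_i\ge1$ with $v=\sigma_y(h)\prod_i f_i^{(q_i,y)}$, $u^{(r,x)}=g\prod_i f_i^{(p_i,y)}$ and $\deg_y\lfloor g\rfloor_y\le\eta$; the corresponding height is $\eta+\max\{\deg_y v-1,\deg_y V\}\in\mathbb Z$, where $\deg_y V$ is the maximal degree of the entries. The height $\varrho$ of a proper $\mathfrak a$ is the minimum of these heights over all admissible bases and all such $u,U,v,V$. **Theorem.** Let $\mathfrak a\subseteq A$ be a $\partial$-finite left ideal that is proper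 with respect to $y$. Let $\varrho$ be its height, let $n=\dim_{K(x,y)}A/\mathfrak a$, and assume that $\phi=\dim_{K(x)}\{W\in A/\mathfrak a\mid\partial_yW=0\}$ is finite (this always holds, with $\phi\le n$, if $\{a\in K(x,y)\mid\delta_y(a)=0\}=K(x)$, as in the differential and difference cases). Then there exist a nonzero operator $T=\sum_i t_i\partial_x^i\in K(x)[\partial_x]$ and some $C\in A$ such that $T-\partial_yC\in\mathfrak a$ and $\operatorname{ord}(T)\le n\varrho+\phi$. -/

import Mathlib

open Polynomial

/-! ## The field `K(x,y)` and its polynomial subrings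

`K[x,y]` is `K[X][X]` (inner variable `x`, outer variable `y`), `K(x)` is `RatFunc K`,
`K(x)[y]` is `(RatFunc K)[X]`, and `K(x,y)` is `RatFunc (RatFunc K)`. -/

/-- The field `K(x)`. -/
abbrev Kx (K : Type*) [Field K] : Type _ := RatFunc K

/-- The field `K(x,y) = K(x)(y)`. -/
abbrev Kxy (K : Type*) [Field K] : Type _ := RatFunc (RatFunc K)

section Basics

variable {K : Type*} [Field K]

/-- The inclusion `K[x,y] → K(x)[y]`. -/
noncomputable def polyToKxY : K[X][X] →+* (Kx K)[X] :=
  Polynomial.mapRingHom (algebraMap K[X] (Kx K))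

/-- The inclusion `K(x)[y] → K(x,y)`. -/
noncomputable def kxYToKxy : (Kx K)[X] →+* Kxy K := algebraMap (Kx K)[X] (Kxy K)

/-- The inclusion `K[x,y] → K(x,y)`. -/
noncomputable def polyToKxy : K[X][X] →+* Kxy K := kxYToKxy.comp polyToKxY

/-- The inclusion `K(x) → K(x,y)`. -/
noncomputable def kxToKxy : Kx K →+* Kxy K := kxYToKxy.comp Polynomial.C

/-- `deg_y p`, with `deg_y 0 = ⊥`. -/
noncomputable def degY (p : K[X][X]) : WithBot ℕ := p.degree

/-- `deg_x p`, with `deg_x 0 = ⊥`. -/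
noncomputable def degX (p : K[X][X]) : WithBot ℕ := p.support.sup fun j => (p.coeff j).degree

end Basics

/-! ## Bivariate Ore algebras -/

/-- The data defining a bivariate Ore algebra over `K(x,y)`: commuting automorphisms
`σ_x, σ_y`, a `K`-linear `σ_x`-derivation `δ_x` and a `K`-linear `σ_y`-derivation `δ_y`, with the
compatibility conditions that express that `∂_x ∂_y = ∂_y ∂_x` is consistent with the commutation
rules, and the conditions on the degrees of images of polynomials. -/
structure OreData (K : Type*) [Field K] where
  σx : Kxy K ≃+* Kxy K
  σy : Kxy K ≃+* Kxy K
  δx : Kxy K →ₗ[K] Kxy K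
  δy : Kxy K →ₗ[K] Kxy K
  δx_mul : ∀ a b, δx (a * b) = δx a * b + σx a * δx b
  δy_mul : ∀ a b, δy (a * b) = δy a * b + σy a * δy b
  σx_σy : ∀ a, σx (σy a) = σy (σx a)
  σx_δy : ∀ a, σx (δy a) = δy (σx a)
  δx_σy : ∀ a, δx (σy a) = σy (δx a)
  δx_δy : ∀ a, δx (δy a) = δy (δx a)
  σx_poly : ∀ p : K[X][X], ∃ q : K[X][X],
    σx (polyToKxy p) = polyToKxy q ∧ degX q = degX p ∧ degY q = degY p
  σy_poly : ∀ p : K[X][X], ∃ q : K[X][X],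
    σy (polyToKxy p) = polyToKxy q ∧ degX q = degX p ∧ degY q = degY p
  /- `deg q + 1 ≤ deg p` reads `q = 0` if `deg p ≤ 0`. -/
  δx_poly : ∀ p : K[X][X], ∃ q : K[X][X],
    δx (polyToKxy p) = polyToKxy q ∧ degX q + 1 ≤ degX p ∧ degY q ≤ degY p
  δy_poly : ∀ p : K[X][X], ∃ q : K[X][X],
    δy (polyToKxy p) = polyToKxy q ∧ degX q ≤ degX p ∧ degY q + 1 ≤ degY p

/-- The underlying set of the Ore algebra `K(x,y)[∂_x,∂_y]`: the element with coefficient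
`a i j` at `(i, j)` is the polynomial `∑ a i j ∂_x^i ∂_y^j`. -/
def OreAlgebra {K : Type*} [Field K] (_D : OreData K) : Type _ := ℕ × ℕ →₀ Kxy K

namespace OreAlgebra

variable {K : Type*} [Field K] {D : OreData K}

noncomputable instance : AddCommGroup (OreAlgebra D) :=
  inferInstanceAs (AddCommGroup (ℕ × ℕ →₀ Kxy K))

noncomputable instance : Module (Kxy K) (OreAlgebra D) :=
  inferInstanceAs (Module (Kxy K) (ℕ × ℕ →₀ Kxy K))

/-- The coefficient of `∂_x^i ∂_y^j`. -/
noncomputable def coeff (P : OreAlgebra D) (i j : ℕ) : Kxy K := (show ℕ × ℕ →₀ Kxy K from P) (i, j)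

/-- The monomial `a ∂_x^i ∂_y^j`, as an additive function of `a`. -/
noncomputable def mono (D : OreData K) (ij : ℕ × ℕ) : Kxy K →+ OreAlgebra D :=
  Finsupp.singleAddHom ij

theorem addHom_ext {N : Type*} [AddZeroClass N] {f g : OreAlgebra D →+ N}
    (h : ∀ ij a, f (mono D ij a) = g (mono D ij a)) : f = g :=
  Finsupp.addHom_ext h

/-- Left multiplication by `∂_x`:
`a ∂_x^i ∂_y^j ↦ σ_x(a) ∂_x^(i+1) ∂_y^j + δ_x(a) ∂_x^i ∂_y^j`. -/
noncomputable def mulDx (D : OreData K) : AddMonoid.End (OreAlgebra D) :=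
  Finsupp.liftAddHom fun ij =>
    (mono D (ij.1 + 1, ij.2)).comp D.σx.toAddEquiv.toAddMonoidHom +
      (mono D ij).comp D.δx.toAddMonoidHom

/-- Left multiplication by `∂_y`:
`a ∂_x^i ∂_y^j ↦ σ_y(a) ∂_x^i ∂_y^(j+1) + δ_y(a) ∂_x^i ∂_y^j`. -/
noncomputable def mulDy (D : OreData K) : AddMonoid.End (OreAlgebra D) :=
  Finsupp.liftAddHom fun ij =>
    (mono D (ij.1, ij.2 + 1)).comp D.σy.toAddEquiv.toAddMonoidHom +
      (mono D ij).comp D.δy.toAddMonoidHom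

/-- Left multiplication by `a ∈ K(x,y)`. -/
noncomputable def mulCoeff (D : OreData K) : Kxy K →+* AddMonoid.End (OreAlgebra D) :=
  Module.toAddMonoidEnd (Kxy K) (OreAlgebra D)

/-- Left multiplication by `∑ a i j ∂_x^i ∂_y^j`. -/
noncomputable def mulLeftHom (D : OreData K) :
    OreAlgebra D →+ AddMonoid.End (OreAlgebra D) :=
  Finsupp.liftAddHom fun ij =>
    (AddMonoidHom.mulRight (mulDx D ^ ij.1 * mulDy D ^ ij.2)).comp
      (mulCoeff D).toAddMonoidHom

theorem mulDx_mono (ij : ℕ × ℕ) (a : Kxy K) :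
    mulDx D (mono D ij a) = mono D (ij.1 + 1, ij.2) (D.σx a) + mono D ij (D.δx a) := by
  exact Finsupp.liftAddHom_apply_single _ _ _

theorem mulDy_mono (ij : ℕ × ℕ) (a : Kxy K) :
    mulDy D (mono D ij a) = mono D (ij.1, ij.2 + 1) (D.σy a) + mono D ij (D.δy a) := by
  exact Finsupp.liftAddHom_apply_single _ _ _

theorem smul_mono (c : Kxy K) (ij : ℕ × ℕ) (a : Kxy K) :
    c • mono D ij a = mono D ij (c * a) :=
  Finsupp.smul_single c ij a

theorem mulCoeff_apply (a : Kxy K) (P : OreAlgebra D) : mulCoeff D a P = a • P := rfl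

theorem mulLeftHom_mono (ij : ℕ × ℕ) (a : Kxy K) :
    mulLeftHom D (mono D ij a) = mulCoeff D a * (mulDx D ^ ij.1 * mulDy D ^ ij.2) := by
  exact Finsupp.liftAddHom_apply_single _ _ _

theorem mulDx_mulCoeff (a : Kxy K) :
    mulDx D * mulCoeff D a = mulCoeff D (D.σx a) * mulDx D + mulCoeff D (D.δx a) := by
  apply addHom_ext
  intro ij b
  change mulDx D (a • mono D ij b) =
    D.σx a • mulDx D (mono D ij b) + D.δx a • mono D ij b
  simp only [smul_mono, mulDx_mono, smul_add, map_mul, D.δx_mul, map_add]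
  abel

theorem mulDy_mulCoeff (a : Kxy K) :
    mulDy D * mulCoeff D a = mulCoeff D (D.σy a) * mulDy D + mulCoeff D (D.δy a) := by
  apply addHom_ext
  intro ij b
  change mulDy D (a • mono D ij b) =
    D.σy a • mulDy D (mono D ij b) + D.δy a • mono D ij b
  simp only [smul_mono, mulDy_mono, smul_add, map_mul, D.δy_mul, map_add]
  abel

theorem mulDx_mulDy : mulDx D * mulDy D = mulDy D * mulDx D := by
  apply addHom_ext
  intro ij b
  change mulDx D (mulDy D (mono D ij b)) = mulDy D (mulDx D (mono D ij b))
  simp only [mulDx_mono, mulDy_mono, map_add, D.σx_σy, D.σx_δy, D.δx_σy, D.δx_δy]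
  abel

theorem mulLeftHom_mulCoeff (a : Kxy K) (Q : OreAlgebra D) :
    mulLeftHom D (mulCoeff D a Q) = mulCoeff D a * mulLeftHom D Q := by
  have : (mulLeftHom D).comp (mulCoeff D a) =
      (AddMonoidHom.mulLeft (mulCoeff D a)).comp (mulLeftHom D) := by
    apply addHom_ext
    intro ij b
    change mulLeftHom D (a • mono D ij b) = mulCoeff D a * mulLeftHom D (mono D ij b)
    simp only [smul_mono, mulLeftHom_mono, map_mul, mul_assoc]
  exact DFunLike.congr_fun this Q

theorem mulLeftHom_mulDx (Q : OreAlgebra D) :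
    mulLeftHom D (mulDx D Q) = mulDx D * mulLeftHom D Q := by
  have : (mulLeftHom D).comp (mulDx D) =
      (AddMonoidHom.mulLeft (mulDx D)).comp (mulLeftHom D) := by
    apply addHom_ext
    intro ij b
    change mulLeftHom D (mulDx D (mono D ij b)) = mulDx D * mulLeftHom D (mono D ij b)
    rw [mulDx_mono, map_add, mulLeftHom_mono, mulLeftHom_mono, mulLeftHom_mono,
      ← mul_assoc (mulDx D), mulDx_mulCoeff, add_mul, pow_succ']
    simp only [mul_assoc]
  exact DFunLike.congr_fun this Q

theorem mulLeftHom_mulDy (Q : OreAlgebra D) :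
    mulLeftHom D (mulDy D Q) = mulDy D * mulLeftHom D Q := by
  have : (mulLeftHom D).comp (mulDy D) =
      (AddMonoidHom.mulLeft (mulDy D)).comp (mulLeftHom D) := by
    apply addHom_ext
    intro ij b
    change mulLeftHom D (mulDy D (mono D ij b)) = mulDy D * mulLeftHom D (mono D ij b)
    have hc : mulDy D * mulDx D ^ ij.1 = mulDx D ^ ij.1 * mulDy D :=
      (Commute.pow_right (mulDx_mulDy (D := D)).symm ij.1)
    rw [mulDy_mono, map_add, mulLeftHom_mono, mulLeftHom_mono, mulLeftHom_mono,
      ← mul_assoc (mulDy D), mulDy_mulCoeff, add_mul, pow_succ',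
      mul_assoc (mulCoeff D (D.σy b)) (mulDy D), ← mul_assoc (mulDy D), hc]
    simp only [mul_assoc]
  exact DFunLike.congr_fun this Q

theorem mulLeftHom_mulLeftHom (P Q : OreAlgebra D) :
    mulLeftHom D (mulLeftHom D P Q) = mulLeftHom D P * mulLeftHom D Q := by
  have hx : ∀ (i : ℕ) (R : OreAlgebra D),
      mulLeftHom D ((mulDx D ^ i) R) = mulDx D ^ i * mulLeftHom D R := by
    intro i
    induction i with
    | zero => intro R; simp
    | succ i ih =>
      intro R
      rw [pow_succ', mul_assoc, ← ih]
      exact mulLeftHom_mulDx _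
  have hy : ∀ (i : ℕ) (R : OreAlgebra D),
      mulLeftHom D ((mulDy D ^ i) R) = mulDy D ^ i * mulLeftHom D R := by
    intro i
    induction i with
    | zero => intro R; simp
    | succ i ih =>
      intro R
      rw [pow_succ', mul_assoc, ← ih]
      exact mulLeftHom_mulDy _
  have : ((mulLeftHom D).comp ((AddMonoidHom.eval Q).comp (mulLeftHom D))) =
      (AddMonoidHom.mulRight (mulLeftHom D Q)).comp (mulLeftHom D) := by
    apply addHom_ext
    intro ij b
    change mulLeftHom D (mulLeftHom D (mono D ij b) Q) =
      mulLeftHom D (mono D ij b) * mulLeftHom D Q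
    rw [mulLeftHom_mono]
    change mulLeftHom D (mulCoeff D b ((mulDx D ^ ij.1) ((mulDy D ^ ij.2) Q))) = _
    rw [mulLeftHom_mulCoeff, hx, hy]
    simp only [mul_assoc]
  exact DFunLike.congr_fun this P

theorem mulDx_pow_mono_one (i k j : ℕ) :
    (mulDx D ^ i) (mono D (k, j) 1) = mono D (k + i, j) 1 := by
  have h1 : D.δx 1 = 0 := by
    have := D.δx_mul 1 1
    simpa using this
  induction i with
  | zero => simp
  | succ i ih =>
    rw [pow_succ']
    change mulDx D ((mulDx D ^ i) _) = _
    rw [ih, mulDx_mono, h1, map_one, map_zero, add_zero, add_assoc]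

theorem mulDy_pow_mono_one (i k j : ℕ) :
    (mulDy D ^ i) (mono D (k, j) 1) = mono D (k, j + i) 1 := by
  have h1 : D.δy 1 = 0 := by
    have := D.δy_mul 1 1
    simpa using this
  induction i with
  | zero => simp
  | succ i ih =>
    rw [pow_succ']
    change mulDy D ((mulDy D ^ i) _) = _
    rw [ih, mulDy_mono, h1, map_one, map_zero, add_zero, add_assoc]

theorem mulLeftHom_apply_one (P : OreAlgebra D) : mulLeftHom D P (mono D (0, 0) 1) = P := by
  have : (AddMonoidHom.eval (mono D (0, 0) 1)).comp (mulLeftHom D) =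
      AddMonoidHom.id (OreAlgebra D) := by
    apply addHom_ext
    intro ij b
    change mulLeftHom D (mono D ij b) (mono D (0, 0) 1) = mono D ij b
    rw [mulLeftHom_mono]
    change b • ((mulDx D ^ ij.1) ((mulDy D ^ ij.2) (mono D (0, 0) 1))) = _
    rw [mulDy_pow_mono_one, mulDx_pow_mono_one, smul_mono]
    simp
  exact DFunLike.congr_fun this P

noncomputable instance : Ring (OreAlgebra D) :=
  { (inferInstance : AddCommGroup (OreAlgebra D)) with
    mul := fun P Q => mulLeftHom D P Q
    one := mono D (0, 0) 1
    mul_assoc := fun P Q R => by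
      change mulLeftHom D (mulLeftHom D P Q) R = mulLeftHom D P (mulLeftHom D Q R)
      rw [mulLeftHom_mulLeftHom]; rfl
    one_mul := fun P => by
      change mulLeftHom D (mono D (0, 0) 1) P = P
      rw [mulLeftHom_mono]; simp
    mul_one := mulLeftHom_apply_one
    zero_mul := fun P => by
      change mulLeftHom D 0 P = 0
      rw [map_zero]; rfl
    mul_zero := fun P => map_zero (mulLeftHom D P)
    left_distrib := fun P Q R => map_add (mulLeftHom D P) Q R
    right_distrib := fun P Q R => by
      change mulLeftHom D (P + Q) R = mulLeftHom D P R + mulLeftHom D Q R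
      rw [map_add]; rfl }

/-- The generator `∂_x`. -/
noncomputable def dx (D : OreData K) : OreAlgebra D := mono D (1, 0) 1

/-- The generator `∂_y`. -/
noncomputable def dy (D : OreData K) : OreAlgebra D := mono D (0, 1) 1

theorem mul_def (P Q : OreAlgebra D) : P * Q = mulLeftHom D P Q := rfl

theorem one_def : (1 : OreAlgebra D) = mono D (0, 0) 1 := rfl

theorem dx_mul (P : OreAlgebra D) : dx D * P = mulDx D P := by
  rw [mul_def, dx, mulLeftHom_mono]; simp

theorem dy_mul (P : OreAlgebra D) : dy D * P = mulDy D P := by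
  rw [mul_def, dy, mulLeftHom_mono]; simp

instance : IsScalarTower (Kxy K) (OreAlgebra D) (OreAlgebra D) where
  smul_assoc a P Q := by
    change mulLeftHom D (mulCoeff D a P) Q = a • mulLeftHom D P Q
    rw [mulLeftHom_mulCoeff]; rfl

/-- The relation `∂_x ∂_y = ∂_y ∂_x`. -/
theorem dx_dy : dx D * dy D = dy D * dx D := by
  have h := DFunLike.congr_fun (mulDx_mulDy (D := D)) 1
  have h' : mulDx D (mulDy D 1) = mulDy D (mulDx D 1) := h
  rw [← dx_mul, ← dy_mul, ← dy_mul, ← dx_mul, mul_one, mul_one] at h'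
  exact h'

/-- The relation `∂_x a = σ_x(a) ∂_x + δ_x(a)`, applied to an element `P`. -/
theorem dx_mul_smul (a : Kxy K) (P : OreAlgebra D) :
    dx D * (a • P) = D.σx a • (dx D * P) + D.δx a • P := by
  rw [dx_mul, dx_mul]
  exact DFunLike.congr_fun (mulDx_mulCoeff (D := D) a) P

/-- The relation `∂_y a = σ_y(a) ∂_y + δ_y(a)`, applied to an element `P`. -/
theorem dy_mul_smul (a : Kxy K) (P : OreAlgebra D) :
    dy D * (a • P) = D.σy a • (dy D * P) + D.δy a • P := by
  rw [dy_mul, dy_mul]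
  exact DFunLike.congr_fun (mulDy_mulCoeff (D := D) a) P

theorem smul_eq_coeff_mul (a : Kxy K) (P : OreAlgebra D) : a • P = (a • (1 : OreAlgebra D)) * P := by
  rw [smul_mul_assoc, one_mul]

/-- The monomial with coefficient `a` at `(i, j)` is the product `a ∂_x^i ∂_y^j`. -/
theorem mono_eq (i j : ℕ) (a : Kxy K) :
    mono D (i, j) a = (a • (1 : OreAlgebra D)) * dx D ^ i * dy D ^ j := by
  have hx : ∀ (i : ℕ) (P : OreAlgebra D), dx D ^ i * P = (mulDx D ^ i) P := by
    intro i
    induction i with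
    | zero => intro P; simp
    | succ i ih => intro P; rw [pow_succ', mul_assoc, ih, dx_mul, pow_succ']; rfl
  have hy : ∀ i : ℕ, dy D ^ i = (mulDy D ^ i) 1 := by
    intro i
    induction i with
    | zero => simp
    | succ i ih => rw [pow_succ', ih, dy_mul, pow_succ']; rfl
  rw [mul_assoc, ← smul_eq_coeff_mul, hy, hx, one_def, mulDy_pow_mono_one, mulDx_pow_mono_one,
    smul_mono]
  simp

noncomputable instance : Module (Kx K) (OreAlgebra D) :=
  Module.compHom (OreAlgebra D) (kxToKxy : Kx K →+* Kxy K)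

instance : IsScalarTower (Kx K) (OreAlgebra D) (OreAlgebra D) where
  smul_assoc a P Q := smul_assoc (kxToKxy a) P Q

/-- The set `K(x)[∂_x]` of operators `∑ t_i ∂_x^i` with `t_i ∈ K(x)`. -/
def xOperators (D : OreData K) : Set (OreAlgebra D) :=
  {T | (∀ i, T.coeff i 0 ∈ Set.range (kxToKxy : Kx K →+* Kxy K)) ∧
    ∀ i j, j ≠ 0 → T.coeff i j = 0}

/-- The order in `∂_x` (used for nonzero elements of `K(x)[∂_x]`): the largest `i` for which some
`∂_x^i ∂_y^j` has a nonzero coefficient. -/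
def ordX (T : OreAlgebra D) : ℕ := (show ℕ × ℕ →₀ Kxy K from T).support.sup Prod.fst

end OreAlgebra

/-! ## Factorial powers and left borders -/

section Borders

variable {K : Type*} [Field K]

/-- `∏_{j < i} σ^j(a)`. -/
noncomputable def facPow (σ : Kxy K ≃+* Kxy K) (a : Kxy K) (i : ℕ) : Kxy K :=
  ∏ j ∈ Finset.range i, σ^[j] a

/-- `q ∈ K(x)[y]` is monic of positive degree and its `n`-th factorial power divides `p` in
`K(x)[y]`. -/
def IsFacFactor (σ : Kxy K ≃+* Kxy K) (p : (Kx K)[X]) (n : ℕ) (q : (Kx K)[X]) : Prop :=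
  q.Monic ∧ 0 < q.degree ∧
    ∃ s : (Kx K)[X], kxYToKxy p = kxYToKxy s * facPow σ (kxYToKxy q) n

/-- `n` is the largest number for which `p` has a factor that is an `n`-th factorial power of a
monic nonconstant polynomial, and `q` is such a polynomial of largest degree. -/
def IsTopFactor (σ : Kxy K ≃+* Kxy K) (p : (Kx K)[X]) (n : ℕ) (q : (Kx K)[X]) : Prop :=
  IsFacFactor σ p n q ∧ (∀ m q', IsFacFactor σ p m q' → m ≤ n) ∧
    ∀ q', IsFacFactor σ p n q' → q'.natDegree ≤ q.natDegree

/-- `IsLeftBorder σ p l`: splitting off top factors `q` of `p` one after the other until a nonzero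
constant in `K(x)` remains, that is, writing `p = c ∏ facPow σ (p_i) i`, gives `l = ∏ p_i`
as the left border of `p`. -/
inductive IsLeftBorder (σ : Kxy K ≃+* Kxy K) : (Kx K)[X] → (Kx K)[X] → Prop
  | const (c : Kx K) (hc : c ≠ 0) : IsLeftBorder σ (Polynomial.C c) 1
  | step (p q s l : (Kx K)[X]) (n : ℕ) (hq : IsTopFactor σ p n q)
      (hs : kxYToKxy p = kxYToKxy s * facPow σ (kxYToKxy q) n)
      (hl : IsLeftBorder σ s l) : IsLeftBorder σ p (q * l)

/-- The left border of `p` has degree at most `d` in `y`. -/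
def LeftBorderDegLE (σ : Kxy K ≃+* Kxy K) (p : (Kx K)[X]) (d : ℕ) : Prop :=
  ∃ l, IsLeftBorder σ p l ∧ l.natDegree ≤ d

/-- A (nonzero) polynomial `u ∈ K[x,y]` is `y`-proper with respect to `σ_x, σ_y` if the degree in
`y` of the left border with respect to `σ_y` of the `r`-th factorial power of `u` with respect to
`σ_x` is bounded as `r → ∞`. -/
def IsYProper (σx σy : Kxy K ≃+* Kxy K) (u : K[X][X]) : Prop :=
  ∃ d : ℕ, ∀ᶠ r : ℕ in Filter.atTop, ∃ P : (Kx K)[X],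
    kxYToKxy P = facPow σx (polyToKxy u) r ∧ LeftBorderDegLE σy P d

/-- The numbers `η` such that for all `r ≥ 1` there are `f_i, g, h ∈ K[x,y]` and `p_i ≥ q_i ≥ 1`
with `v = σ_y(h) ∏ f_i^{(q_i, y)}` and `u^{(r, x)} = g ∏ f_i^{(p_i, y)}`
(factorial powers), where the left border of `g` has degree at most `η` in `y`. -/
def etaSet (σx σy : Kxy K ≃+* Kxy K) (u v : K[X][X]) : Set ℕ :=
  {η | ∀ r : ℕ, 1 ≤ r → ∃ (m : ℕ) (f : Fin m → K[X][X]) (g h : K[X][X]) (p q : Fin m → ℕ),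
    (∀ i, q i ≤ p i ∧ 1 ≤ q i) ∧
    polyToKxy v = σy (polyToKxy h) * ∏ i, facPow σy (polyToKxy (f i)) (q i) ∧
    facPow σx (polyToKxy u) r = polyToKxy g * ∏ i, facPow σy (polyToKxy (f i)) (p i) ∧
    LeftBorderDegLE σy (polyToKxY g) η}

open scoped Classical in
/-- `max {deg_y v - 1, deg_y V}` for `v ≠ 0`, where `deg_y V` is the largest degree of a nonzero
entry of `V` (and the zero matrix does not contribute). -/
noncomputable def maxDegY {n : ℕ} (v : K[X][X]) (V : Matrix (Fin n) (Fin n) K[X][X]) : ℤ :=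
  (Finset.univ.filter fun ij : Fin n × Fin n => V ij.1 ij.2 ≠ 0).fold max
    ((v.natDegree : ℤ) - 1) fun ij => ((V ij.1 ij.2).natDegree : ℤ)

end Borders

/-! ## Proper `∂`-finite left ideals and their height -/

section Ideals

variable {K : Type*} [Field K] {D : OreData K}

/-- A left ideal is `∂`-finite if its quotient is a finite-dimensional `K(x,y)`-space. (For the
noncommutative ring `OreAlgebra D`, `Ideal` means left ideal.) -/
def IsDFinite (I : Ideal (OreAlgebra D)) : Prop := Module.Finite (Kxy K) (OreAlgebra D ⧸ I)

/-- A basis of `A/I` is (`y`-)admissible if `1` is represented by a vector over `K(x)[y]`. -/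
def IsAdmissible {I : Ideal (OreAlgebra D)} {n : ℕ}
    (b : Module.Basis (Fin n) (Kxy K) (OreAlgebra D ⧸ I)) : Prop :=
  ∀ i, b.repr (Submodule.Quotient.mk 1) i ∈ Set.range (kxYToKxy : (Kx K)[X] →+* Kxy K)

/-- `d b = (1/u) U b` for the basis `b` of `A/I`, where `d ∈ A`, `u ∈ K[x,y]` is nonzero and
`U` is a matrix over `K[x,y]`. -/
def IsMulMatrix {I : Ideal (OreAlgebra D)} {n : ℕ}
    (b : Module.Basis (Fin n) (Kxy K) (OreAlgebra D ⧸ I)) (d : OreAlgebra D)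
    (u : K[X][X]) (U : Matrix (Fin n) (Fin n) K[X][X]) : Prop :=
  u ≠ 0 ∧ ∀ i, d • b i = ∑ j, (polyToKxy (U i j) / polyToKxy u) • b j

/-- Proper (with respect to `y`) `∂`-finite left ideals. -/
def IsProperDFinite (I : Ideal (OreAlgebra D)) : Prop :=
  IsDFinite I ∧ ∃ (n : ℕ) (b : Module.Basis (Fin n) (Kxy K) (OreAlgebra D ⧸ I))
    (u : K[X][X]) (U : Matrix (Fin n) (Fin n) K[X][X]),
    IsAdmissible b ∧ IsMulMatrix b (OreAlgebra.dx D) u U ∧ IsYProper D.σx D.σy u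

/-- The heights of `I` with respect to admissible bases: `η + max {deg_y v - 1, deg_y V}`, where
the multiplication matrices of `∂_x` and `∂_y` are `(1/u) U` and `(1/v) V`, the polynomial `u` is
`y`-proper, and `η` is the smallest element of `etaSet`. -/
def heightSet (I : Ideal (OreAlgebra D)) : Set ℤ :=
  {ρ | ∃ (n : ℕ) (b : Module.Basis (Fin n) (Kxy K) (OreAlgebra D ⧸ I))
    (u v : K[X][X]) (U V : Matrix (Fin n) (Fin n) K[X][X]) (η : ℕ),
    IsAdmissible b ∧ IsMulMatrix b (OreAlgebra.dx D) u U ∧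
    IsMulMatrix b (OreAlgebra.dy D) v V ∧ IsYProper D.σx D.σy u ∧
    IsLeast (etaSet D.σx D.σy u v) η ∧ ρ = η + maxDegY v V}

/-- The height of a proper `∂`-finite left ideal: the smallest element of `heightSet`. -/
noncomputable def height (I : Ideal (OreAlgebra D)) : ℤ := sInf (heightSet I)

theorem polyToKxy_ne_zero {p : K[X][X]} (hp : p ≠ 0) : polyToKxy p ≠ 0 := by
  have h1 : Function.Injective (polyToKxY : K[X][X] → (Kx K)[X]) :=
    Polynomial.map_injective _ (IsFractionRing.injective K[X] (Kx K))
  have h2 : Function.Injective (kxYToKxy : (Kx K)[X] → Kxy K) :=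
    IsFractionRing.injective (Kx K)[X] (Kxy K)
  intro h
  apply hp
  apply h1
  apply h2
  rw [map_zero, map_zero]
  exact h

/-- `δ_y` vanishes on `K(x)`. -/
theorem OreData.δy_kx (D : OreData K) (c : Kx K) : D.δy (kxToKxy c) = 0 := by
  have hpoly : ∀ a : K[X], D.δy (kxToKxy (algebraMap K[X] (Kx K) a)) = 0 := by
    intro a
    have ha : kxToKxy (algebraMap K[X] (Kx K) a) = polyToKxy (Polynomial.C a) := by
      simp [kxToKxy, polyToKxy, polyToKxY]
    obtain ⟨q, hq, -, hdeg⟩ := D.δy_poly (Polynomial.C a)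
    have hq0 : q = 0 := by
      by_contra h
      have h1 : (0 : WithBot ℕ) ≤ degY q := Polynomial.zero_le_degree_iff.mpr h
      have h2 : degY (Polynomial.C a) ≤ 0 := Polynomial.degree_C_le
      have h3 : (1 : WithBot ℕ) ≤ 0 :=
        calc (1 : WithBot ℕ) = 0 + 1 := (zero_add 1).symm
          _ ≤ degY q + 1 := by gcongr
          _ ≤ 0 := hdeg.trans h2
      exact absurd h3 (by decide)
    rw [ha, hq, hq0, map_zero]
  obtain ⟨a, s, hs, rfl⟩ := IsFractionRing.div_surjective (A := K[X]) c
  set S := kxToKxy (algebraMap K[X] (Kx K) s) with hS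
  have hS0 : S ≠ 0 := by
    rw [hS]
    simpa using nonZeroDivisors.ne_zero hs
  have hmul : kxToKxy (algebraMap K[X] (Kx K) a / algebraMap K[X] (Kx K) s) * S =
      kxToKxy (algebraMap K[X] (Kx K) a) := by
    rw [map_div₀, ← hS, div_mul_cancel₀ _ hS0]
  have h := D.δy_mul (kxToKxy (algebraMap K[X] (Kx K) a / algebraMap K[X] (Kx K) s)) S
  rw [hmul, hpoly, hS, hpoly, mul_zero, add_zero, ← hS] at h
  exact (mul_eq_zero.mp h.symm).resolve_right hS0

/-- The `K(x)`-space `{W ∈ A/I | ∂_y W = 0}`. -/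
def dyKernel (I : Ideal (OreAlgebra D)) : Submodule (Kx K) (OreAlgebra D ⧸ I) where
  carrier := {W | OreAlgebra.dy D • W = 0}
  add_mem' := fun {V W} hV hW => by
    change OreAlgebra.dy D • (V + W) = 0
    rw [smul_add, hV, hW, add_zero]
  zero_mem' := smul_zero _
  smul_mem' := fun c W hW => by
    obtain ⟨P, rfl⟩ := Submodule.Quotient.mk_surjective I W
    change (Submodule.Quotient.mk (OreAlgebra.dy D * (kxToKxy c • P)) : OreAlgebra D ⧸ I) = 0
    have hW' : (Submodule.Quotient.mk (OreAlgebra.dy D * P) : OreAlgebra D ⧸ I) = 0 := hW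
    rw [OreAlgebra.dy_mul_smul, D.δy_kx, zero_smul, add_zero, Submodule.Quotient.mk_smul, hW',
      smul_zero]

end Ideals

/-! ### Fractions, denominators and degree-preserving automorphisms. -/

section FunctionField

variable {K : Type*} [Field K]

/-! The proof is an ansatz settled by counting dimensions over $K(x)$. Choose an admissible basis
$b$ that attains the height $\varrho=\eta+\max\{\deg_y v-1,\deg_y V\}$, and put $G=u^{(r+1,x)}$. The
classes $\partial_x^i\cdot 1$ with $i<r$ have coordinates in $G^{-1}K(x)[y]$
(`facPow_mul_repr_dx_pow_mem`).

From the factorizations behind $\eta$ one builds a nonzero $w\in K(x,y)$ for which $G\sigma_y(w)$ is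
a multiple of $v$ and $G\delta_y(w)$ is polynomial in $y$, with degrees under control
(`exists_antiderivative_denominator`). Hence $\partial_y(y^k w\,b_j)$ also has coordinates in
$G^{-1}K(x)[y]$, with numerators of degree at most $k+\varrho$ (`mul_repr_dy_mem_and_degLE`).

Take $N$ so large that all numerators of the $\partial_x^i\cdot 1$ have degree at most $N$, and let
$k$ run below $S=N+1-\varrho$. Then $r+nS$ vectors lie in a space of dimension at most $n(N+1)$, so
their relations have dimension at least $r-n\varrho$. The numerator degrees of the
$\partial_x^i\cdot 1$ drop out of this count.

If no nonzero $\sum t_i\partial_x^i\cdot 1$ were of the form $\partial_yW$, every relation would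
involve only the $\partial_y(y^kw\,b_j)$ and would come from an element of $\ker\partial_y$, leaving
at most $\phi$ dimensions (`finrank_ker_le_of_forall_eq_zero`). So $r>n\varrho+\phi$ forces a
telescoper. As $\partial_y$ is only $\sigma_y$-semilinear over $K(x)$, this comparison needs
$\sigma_y(K(x))=K(x)$, which follows from the preservation of degrees. -/

theorem kxYToKxy_injective : Function.Injective (kxYToKxy : (Kx K)[X] → Kxy K) :=
  IsFractionRing.injective (Kx K)[X] (Kxy K)

theorem polyToKxY_injective : Function.Injective (polyToKxY : K[X][X] → (Kx K)[X]) :=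
  Polynomial.map_injective _ (IsFractionRing.injective K[X] (Kx K))

theorem polyToKxy_injective : Function.Injective (polyToKxy : K[X][X] → Kxy K) :=
  kxYToKxy_injective.comp polyToKxY_injective

theorem polyToKxy_apply (p : K[X][X]) : polyToKxy p = kxYToKxy (polyToKxY p) := rfl

theorem degree_polyToKxY (p : K[X][X]) : (polyToKxY p).degree = degY p :=
  Polynomial.degree_map_eq_of_injective (IsFractionRing.injective K[X] (Kx K)) p

theorem polyToKxY_C (s : K[X]) : polyToKxY (C s) = C (algebraMap K[X] (Kx K) s) := by
  simp [polyToKxY]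

theorem polyToKxy_C (s : K[X]) : polyToKxy (C s) = kxToKxy (algebraMap K[X] (Kx K) s) := by
  rw [polyToKxy_apply, polyToKxY_C]; rfl

theorem kxYToKxy_C (c : Kx K) : kxYToKxy (C c) = kxToKxy c := rfl

/-- Clearing denominators in `K(x)[y]`. -/
theorem exists_mul_eq_polyToKxY (p : (Kx K)[X]) :
    ∃ (s : K[X]) (P : K[X][X]), s ≠ 0 ∧ C (algebraMap K[X] (Kx K) s) * p = polyToKxY P := by
  obtain ⟨s, hs, h⟩ := IsLocalization.integerNormalization_spec (nonZeroDivisors K[X]) p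
  refine ⟨s, IsLocalization.integerNormalization (nonZeroDivisors K[X]) p,
    nonZeroDivisors.ne_zero hs, ?_⟩
  rw [polyToKxY, Polynomial.coe_mapRingHom, h, ← Polynomial.smul_eq_C_mul]
  ext1 k
  simp [Algebra.smul_def]

/-- Every element of `K(x,y)` is a fraction of elements of `K[x,y]`. -/
theorem exists_mul_polyToKxy_eq (a : Kxy K) :
    ∃ p q : K[X][X], q ≠ 0 ∧ a * polyToKxy q = polyToKxy p := by
  obtain ⟨n, d, hd, rfl⟩ := IsFractionRing.div_surjective (A := (Kx K)[X]) a
  obtain ⟨s, P, hs, hP⟩ := exists_mul_eq_polyToKxY n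
  obtain ⟨t, Q, ht, hQ⟩ := exists_mul_eq_polyToKxY d
  have hd0 : d ≠ 0 := nonZeroDivisors.ne_zero hd
  have hs' : (C (algebraMap K[X] (Kx K) s)) ≠ 0 := by simpa using hs
  have ht' : (C (algebraMap K[X] (Kx K) t)) ≠ 0 := by simpa using ht
  refine ⟨C t * P, C s * Q, ?_, ?_⟩
  · refine mul_ne_zero (by simpa using hs) fun h => ?_
    rw [h, map_zero] at hQ
    exact mul_ne_zero ht' hd0 hQ
  · have hd1 : kxYToKxy d ≠ 0 := fun h => hd0 (kxYToKxy_injective (by rw [h, map_zero]))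
    rw [map_mul, map_mul, polyToKxy_apply, polyToKxy_apply, polyToKxy_apply, polyToKxy_apply,
      ← hP, ← hQ, polyToKxY_C, polyToKxY_C, map_mul, map_mul]
    change kxYToKxy n / kxYToKxy d * _ = _
    field_simp

/-- Finitely many elements of `K(x,y)` have a common denominator in `K[x,y]`. -/
theorem exists_common_denominator {ι : Type*} (s : Finset ι) (a : ι → Kxy K) :
    ∃ q : K[X][X], q ≠ 0 ∧ ∀ i ∈ s, ∃ p : K[X][X], a i * polyToKxy q = polyToKxy p := by
  classical
  induction s using Finset.induction_on with
  | empty => exact ⟨1, one_ne_zero, by simp⟩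
  | insert i s hi ih =>
    obtain ⟨q, hq, h⟩ := ih
    obtain ⟨p', q', hq', h'⟩ := exists_mul_polyToKxy_eq (a i)
    refine ⟨q * q', mul_ne_zero hq hq', fun k hk => ?_⟩
    rcases Finset.mem_insert.mp hk with rfl | hk
    · exact ⟨q * p', by rw [map_mul, map_mul, ← h']; ring⟩
    · obtain ⟨p, hp⟩ := h k hk
      exact ⟨p * q', by rw [map_mul, map_mul, ← hp]; ring⟩

/-- The automorphism `σ` maps `K[x,y]` to itself and preserves degrees. -/
def PreservesDegrees (σ : Kxy K ≃+* Kxy K) : Prop :=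
  ∀ p : K[X][X], ∃ q : K[X][X],
    σ (polyToKxy p) = polyToKxy q ∧ degX q = degX p ∧ degY q = degY p

theorem degX_C (s : K[X]) : degX (C s) = s.degree := by
  rcases eq_or_ne s 0 with rfl | hs
  · simp [degX]
  · simp [degX, Polynomial.support_C hs]

namespace PreservesDegrees

variable {σ : Kxy K ≃+* Kxy K}

theorem exists_C (hσ : PreservesDegrees σ) (s : K[X]) :
    ∃ t : K[X], σ (polyToKxy (C s)) = polyToKxy (C t) ∧ t.degree = s.degree := by
  obtain ⟨q, hq, hx, hy⟩ := hσ (C s)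
  have h0 : q.degree ≤ 0 := by
    change degY q ≤ 0
    rw [hy]; exact Polynomial.degree_C_le
  rw [Polynomial.eq_C_of_degree_le_zero h0] at hq hx
  exact ⟨_, hq, by rw [degX_C, degX_C] at hx; exact hx⟩

theorem exists_kx (hσ : PreservesDegrees σ) (c : Kx K) : ∃ c', σ (kxToKxy c) = kxToKxy c' := by
  obtain ⟨n, d, -, rfl⟩ := IsFractionRing.div_surjective (A := K[X]) c
  obtain ⟨n', hn, -⟩ := hσ.exists_C n
  obtain ⟨d', hd, -⟩ := hσ.exists_C d
  rw [polyToKxy_C, polyToKxy_C] at hn hd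
  exact ⟨algebraMap K[X] (Kx K) n' / algebraMap K[X] (Kx K) d', by
    rw [map_div₀, map_div₀, map_div₀, hn, hd]⟩

theorem exists_kxY (hσ : PreservesDegrees σ) (p : (Kx K)[X]) :
    ∃ q : (Kx K)[X], σ (kxYToKxy p) = kxYToKxy q ∧ q.degree = p.degree := by
  obtain ⟨s, P, hs, hP⟩ := exists_mul_eq_polyToKxY p
  obtain ⟨t, ht, hd⟩ := hσ.exists_C s
  obtain ⟨Q, hQ, -, hdeg⟩ := hσ P
  have ht0 : t ≠ 0 := by
    rintro rfl
    rw [Polynomial.degree_zero, eq_comm, Polynomial.degree_eq_bot] at hd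
    exact hs hd
  have ht1 : algebraMap K[X] (Kx K) t ≠ 0 := by simpa using ht0
  have hs1 : algebraMap K[X] (Kx K) s ≠ 0 := by simpa using hs
  refine ⟨C (algebraMap K[X] (Kx K) t)⁻¹ * polyToKxY Q, ?_, ?_⟩
  · have h1 : σ (polyToKxy (C s)) * σ (kxYToKxy p) = polyToKxy Q := by
      rw [← map_mul, ← hQ, polyToKxy_apply, polyToKxy_apply, ← hP, polyToKxY_C, ← map_mul]
    have h2 : kxToKxy (algebraMap K[X] (Kx K) t) ≠ 0 := by simpa using ht1
    rw [ht, polyToKxy_C] at h1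
    rw [map_mul, kxYToKxy_C, map_inv₀, ← polyToKxy_apply, ← h1, inv_mul_cancel_left₀ h2]
  · rw [Polynomial.degree_C_mul (inv_ne_zero ht1), degree_polyToKxY, hdeg, ← degree_polyToKxY,
      ← hP, Polynomial.degree_C_mul hs1]

end PreservesDegrees
end FunctionField

/-! ### Degree-preserving automorphisms map $K[x,y]$ and $K(x)$ onto themselves. -/

section Surjectivity

variable {K : Type*} [Field K]

theorem degree_coeff_le_degX (p : K[X][X]) (k : ℕ) : (p.coeff k).degree ≤ degX p := by
  by_cases hk : k ∈ p.support
  · exact Finset.le_sup (f := fun j => (p.coeff j).degree) hk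
  · rw [Polynomial.notMem_support_iff.mp hk, Polynomial.degree_zero]; exact bot_le

theorem degX_X : degX (X : K[X][X]) = 0 := by
  rw [degX, Polynomial.support_X]
  simp

/-- A polynomial with a nonzero constant multiple of the degree of another one is obtained from
cancelling the leading terms. -/
theorem degree_cross_sub_lt {R : Type*} [CommRing R] [IsDomain R] {a b : R[X]} (ha : a ≠ 0)
    (hb : b ≠ 0) (h : a.degree = b.degree) :
    (C b.leadingCoeff * a - C a.leadingCoeff * b).degree < b.degree := by
  have hA : a.leadingCoeff ≠ 0 := by simpa using ha
  have hB : b.leadingCoeff ≠ 0 := by simpa using hb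
  have h1 := Polynomial.degree_C_mul (p := a) hB
  have h2 := Polynomial.degree_C_mul (p := b) hA
  rw [← h, ← h1]
  refine Polynomial.degree_sub_lt_left ?_ ?_ ?_
  · rw [h1, h2, h]
  · exact mul_ne_zero (by simpa using hb) ha
  · rw [Polynomial.leadingCoeff_mul, Polynomial.leadingCoeff_mul, Polynomial.leadingCoeff_C,
      Polynomial.leadingCoeff_C, mul_comm]

namespace PreservesDegrees

variable {σ : Kxy K ≃+* Kxy K}

theorem exists_const (hσ : PreservesDegrees σ) (c : K) :
    ∃ d : K, σ (polyToKxy (C (C c))) = polyToKxy (C (C d)) := by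
  obtain ⟨t, ht, hd⟩ := hσ.exists_C (C c)
  have h0 : t.degree ≤ 0 := hd.trans_le Polynomial.degree_C_le
  rw [Polynomial.eq_C_of_degree_le_zero h0] at ht
  exact ⟨_, ht⟩

/-- Cancelling leading terms, $\mathrm{lc}(b)a-\mathrm{lc}(a)b$ has smaller $y$-degree than $b$. Its
image under $\sigma$ is $\sigma(b)$ times $c\,\sigma(\mathrm{lc}(b))-\sigma(\mathrm{lc}(a))\in
K[x]$, and preservation of $\deg_y$ forces this factor to vanish. -/
theorem map_leadingCoeff (hσ : PreservesDegrees σ) {c : K} {a b : K[X][X]} (ha : a ≠ 0)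
    (hb : b ≠ 0) (hc : c ≠ 0) (h : σ (polyToKxy a) = polyToKxy (C (C c)) * σ (polyToKxy b)) :
    σ (polyToKxy (C a.leadingCoeff)) =
      polyToKxy (C (C c)) * σ (polyToKxy (C b.leadingCoeff)) := by
  obtain ⟨A, hA, -, hdA⟩ := hσ a
  obtain ⟨B, hB, -, hdB⟩ := hσ b
  obtain ⟨s, hs, -⟩ := hσ.exists_C a.leadingCoeff
  obtain ⟨t, ht, -⟩ := hσ.exists_C b.leadingCoeff
  obtain ⟨E, hE, -, hdE⟩ := hσ (C b.leadingCoeff * a - C a.leadingCoeff * b)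
  have hAB : A = C (C c) * B := by
    apply polyToKxy_injective
    rw [← hA, h, hB, map_mul]
  have hdeg : a.degree = b.degree := by
    change degY a = degY b
    rw [← hdA, ← hdB, hAB]
    exact Polynomial.degree_C_mul (by simpa using hc)
  have hE' : E = C (t * C c - s) * B := by
    apply polyToKxy_injective
    rw [← hE, map_sub, map_mul, map_mul, map_sub, map_mul, map_mul, hs, ht, hA, hB, hAB, map_mul,
      map_sub, map_mul]
    simp only [map_mul, map_sub]
    ring
  have hlt := degree_cross_sub_lt ha hb hdeg
  have : t * C c - s = 0 := by
    by_contra hne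
    change degY _ < degY b at hlt
    rw [← hdE, ← hdB, hE'] at hlt
    exact absurd (Polynomial.degree_C_mul hne) hlt.ne
  rw [hs, ht, ← sub_eq_zero.mp this, ← map_mul, ← map_mul, mul_comm]

theorem map_leadingCoeff_C (hσ : PreservesDegrees σ) {c : K} {a b : K[X]} (ha : a ≠ 0)
    (hb : b ≠ 0) (hc : c ≠ 0)
    (h : σ (polyToKxy (C a)) = polyToKxy (C (C c)) * σ (polyToKxy (C b))) :
    σ (polyToKxy (C (C a.leadingCoeff))) =
      polyToKxy (C (C c)) * σ (polyToKxy (C (C b.leadingCoeff))) := by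
  have hinj : Function.Injective fun p : K[X] => polyToKxy (C p) :=
    polyToKxy_injective.comp Polynomial.C_injective
  obtain ⟨A, hA, hdA⟩ := hσ.exists_C a
  obtain ⟨B, hB, hdB⟩ := hσ.exists_C b
  obtain ⟨s, hs⟩ := hσ.exists_const a.leadingCoeff
  obtain ⟨t, ht⟩ := hσ.exists_const b.leadingCoeff
  obtain ⟨E, hE, hdE⟩ := hσ.exists_C (C b.leadingCoeff * a - C a.leadingCoeff * b)
  have hAB : A = C c * B := by
    apply hinj
    change polyToKxy (C A) = polyToKxy (C (C c * B))
    rw [← hA, h, hB, map_mul, map_mul]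
  have hdeg : a.degree = b.degree := by
    rw [← hdA, ← hdB, hAB]
    exact Polynomial.degree_C_mul hc
  have hE' : E = C (t * c - s) * B := by
    apply hinj
    change polyToKxy (C E) = polyToKxy (C (C (t * c - s) * B))
    rw [← hE]
    simp only [map_mul, map_sub, hs, ht, hA, hB, hAB]
    ring
  have hlt := degree_cross_sub_lt ha hb hdeg
  have : t * c - s = 0 := by
    by_contra hne
    rw [← hdE, ← hdB, hE'] at hlt
    exact absurd (Polynomial.degree_C_mul hne) hlt.ne
  rw [hs, ht, ← sub_eq_zero.mp this, ← map_mul, ← map_mul, ← map_mul, mul_comm]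

/-- Since $\sigma$ is not assumed to be $K$-linear, this needs an argument. Write
$\sigma^{-1}(c)=a/b$ and pass to leading coefficients in $y$, then in $x$: the relation
$\sigma(a)=c\,\sigma(b)$ descends to elements of $K$. -/
theorem const_surjective (hσ : PreservesDegrees σ) (c : K) :
    ∃ d : K, σ (polyToKxy (C (C d))) = polyToKxy (C (C c)) := by
  rcases eq_or_ne c 0 with rfl | hc
  · exact ⟨0, by simp⟩
  obtain ⟨a, b, hb, hab⟩ := exists_mul_polyToKxy_eq (σ.symm (polyToKxy (C (C c))))
  have h : σ (polyToKxy a) = polyToKxy (C (C c)) * σ (polyToKxy b) := by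
    rw [← hab, map_mul, RingEquiv.apply_symm_apply]
  have ha : a ≠ 0 := by
    rintro rfl
    rw [map_zero, map_zero, eq_comm, mul_eq_zero] at h
    rcases h with h | h
    · exact polyToKxy_ne_zero (by simpa using hc) h
    · exact polyToKxy_ne_zero hb (by simpa using h)
  have h2 := hσ.map_leadingCoeff_C (by simpa using ha) (by simpa using hb) hc
    (hσ.map_leadingCoeff ha hb hc h)
  have hB : b.leadingCoeff.leadingCoeff ≠ 0 := by simpa using hb
  refine ⟨a.leadingCoeff.leadingCoeff / b.leadingCoeff.leadingCoeff, ?_⟩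
  have hB' : σ (polyToKxy (C (C b.leadingCoeff.leadingCoeff))) ≠ 0 := by
    simpa using polyToKxy_ne_zero (p := C (C b.leadingCoeff.leadingCoeff)) (by simpa using hb)
  apply mul_right_cancel₀ hB'
  rw [← h2, ← map_mul, ← map_mul, ← map_mul, ← map_mul, div_mul_cancel₀ _ hB]

/-- An automorphism that preserves `K[x,y]` and degrees maps `K[x,y]` onto itself. -/
theorem poly_surjective (hσ : PreservesDegrees σ) (p : K[X][X]) :
    ∃ h : K[X][X], σ (polyToKxy h) = polyToKxy p := by
  -- The polynomials in $\sigma(K[x,y])$ form a subring, so it is enough to find the constants, $x$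
  -- and $y$ in it.
  let S : Subring K[X][X] :=
    (((polyToKxy : K[X][X] →+* Kxy K).range.map (σ : Kxy K →+* Kxy K)).comap polyToKxy)
  have hS : ∀ p, p ∈ S ↔ ∃ h : K[X][X], σ (polyToKxy h) = polyToKxy p := by
    intro p
    simp [S, Subring.mem_comap, Subring.mem_map]
  have hc : ∀ c : K, C (C c) ∈ S := fun c => by
    obtain ⟨d, hd⟩ := hσ.const_surjective c
    exact (hS _).mpr ⟨_, hd⟩
  have hx : C X ∈ S := by
    obtain ⟨t, ht, hd⟩ := hσ.exists_C (X : K[X])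
    rw [Polynomial.degree_X] at hd
    have ht' : C t ∈ S := (hS _).mpr ⟨_, ht⟩
    have h1 := Polynomial.eq_X_add_C_of_degree_le_one hd.le
    have h0 : t.coeff 1 ≠ 0 := Polynomial.coeff_ne_zero_of_eq_degree hd
    have : (C X : K[X][X]) = C (C (t.coeff 1)⁻¹) * (C t - C (C (t.coeff 0))) := by
      conv_rhs => rw [h1]
      rw [← map_sub, ← map_mul]
      simp only [coeff_add, coeff_C_mul, coeff_X_zero, mul_zero, coeff_C_zero, zero_add,
        add_sub_cancel_right]
      rw [← mul_assoc, ← map_mul]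
      simp [h0]
    rw [this]
    exact S.mul_mem (hc _) (S.sub_mem ht' (hc _))
  have hCS : ∀ s : K[X], C s ∈ S := by
    intro s
    induction s using Polynomial.induction_on' with
    | add p q hp hq => rw [map_add]; exact S.add_mem hp hq
    | monomial n a =>
      rw [← Polynomial.C_mul_X_pow_eq_monomial, map_mul, map_pow]
      exact S.mul_mem (hc a) (S.pow_mem hx n)
  have hy : X ∈ S := by
    obtain ⟨q, hq, hdx, hdy⟩ := hσ (X : K[X][X])
    have hq' : q ∈ S := (hS _).mpr ⟨_, hq⟩
    have hdy' : q.degree = 1 := by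
      change degY q = 1
      rw [hdy]; exact Polynomial.degree_X
    rw [degX_X] at hdx
    have h1 := Polynomial.eq_X_add_C_of_degree_le_one hdy'.le
    have h0 : q.coeff 1 ≠ 0 := Polynomial.coeff_ne_zero_of_eq_degree hdy'
    -- Because $\deg_x\sigma(y)=0$, the coefficient of $y$ in $\sigma(y)$ is a constant and can be
    -- inverted.
    have h2 := Polynomial.eq_C_of_degree_le_zero ((degree_coeff_le_degX q 1).trans hdx.le)
    set α := (q.coeff 1).coeff 0
    have hα : α ≠ 0 := by
      intro h
      rw [h, map_zero] at h2
      exact h0 h2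
    have h3 : C (q.coeff 1) * X = q - C (q.coeff 0) := eq_sub_of_add_eq h1.symm
    have : (X : K[X][X]) = C (C α⁻¹) * (q - C (q.coeff 0)) := by
      rw [← h3, h2, ← mul_assoc, ← map_mul, ← map_mul]
      simp [hα]
    rw [this]
    exact S.mul_mem (hc _) (S.sub_mem hq' (hCS _))
  rw [← hS]
  induction p using Polynomial.induction_on' with
  | add p q hp hq => exact S.add_mem hp hq
  | monomial n a =>
    rw [← Polynomial.C_mul_X_pow_eq_monomial]
    exact S.mul_mem (hCS a) (S.pow_mem hy n)

theorem kx_surjective (hσ : PreservesDegrees σ) (c : Kx K) :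
    ∃ d : Kx K, σ (kxToKxy d) = kxToKxy c := by
  have key : ∀ n : K[X], ∃ m : K[X], σ (polyToKxy (C m)) = polyToKxy (C n) := by
    intro n
    obtain ⟨h, hh⟩ := hσ.poly_surjective (C n)
    obtain ⟨q, hq, -, hd⟩ := hσ h
    have hq' : q = C n := polyToKxy_injective (by rw [← hq, hh])
    have h0 : h.degree ≤ 0 := by
      change degY h ≤ 0
      rw [← hd, hq']; exact Polynomial.degree_C_le
    rw [Polynomial.eq_C_of_degree_le_zero h0] at hh
    exact ⟨_, hh⟩
  obtain ⟨n, d, -, rfl⟩ := IsFractionRing.div_surjective (A := K[X]) c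
  obtain ⟨n', hn⟩ := key n
  obtain ⟨d', hd⟩ := key d
  rw [polyToKxy_C, polyToKxy_C] at hn hd
  exact ⟨algebraMap K[X] (Kx K) n' / algebraMap K[X] (Kx K) d', by
    rw [map_div₀, map_div₀, map_div₀, hn, hd]⟩

end PreservesDegrees
end Surjectivity

/-! ### Factorial powers, degrees in $y$ and skew derivations. -/

section FactorialPowers

variable {K : Type*} [Field K] {σ : Kxy K ≃+* Kxy K}

theorem facPow_zero (a : Kxy K) : facPow σ a 0 = 1 := by simp [facPow]

theorem facPow_one (a : Kxy K) : facPow σ a 1 = a := by simp [facPow]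

theorem facPow_succ (a : Kxy K) (n : ℕ) : facPow σ a (n + 1) = facPow σ a n * σ^[n] a :=
  Finset.prod_range_succ _ _

theorem map_facPow (a : Kxy K) (n : ℕ) : σ (facPow σ a n) = facPow σ (σ a) n := by
  rw [facPow, facPow, map_prod]
  refine Finset.prod_congr rfl fun j _ => ?_
  exact (Function.iterate_succ_apply' σ j a).symm.trans (Function.iterate_succ_apply σ j a)

theorem facPow_succ' (a : Kxy K) (n : ℕ) : facPow σ a (n + 1) = a * σ (facPow σ a n) := by
  rw [map_facPow, facPow, facPow, Finset.prod_range_succ', mul_comm]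
  rfl

theorem facPow_add (a : Kxy K) (m n : ℕ) :
    facPow σ a (m + n) = facPow σ a m * facPow σ (σ^[m] a) n := by
  rw [facPow, Finset.prod_range_add]
  congr 1
  refine Finset.prod_congr rfl fun j _ => ?_
  rw [← Function.iterate_add_apply, add_comm]

theorem facPow_congr_of_add_eq (a : Kxy K) {m n k : ℕ} (h : m + n = k) :
    facPow σ a k = facPow σ a m * facPow σ (σ^[m] a) n := by
  rw [← h, facPow_add]

theorem iterate_ne_zero {a : Kxy K} (ha : a ≠ 0) (n : ℕ) : σ^[n] a ≠ 0 := by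
  induction n with
  | zero => exact ha
  | succ n ih => rw [Function.iterate_succ_apply']; simpa using ih

theorem facPow_ne_zero {a : Kxy K} (ha : a ≠ 0) (n : ℕ) : facPow σ a n ≠ 0 :=
  Finset.prod_ne_zero_iff.mpr fun j _ => iterate_ne_zero ha j

/-- The subring `K(x)[y]` of `K(x,y)`. -/
noncomputable abbrev kxYRange (K : Type*) [Field K] : Subring (Kxy K) :=
  (kxYToKxy : (Kx K)[X] →+* Kxy K).range

theorem kxYToKxy_mem (p : (Kx K)[X]) : kxYToKxy p ∈ kxYRange K := ⟨p, rfl⟩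

theorem polyToKxy_mem (p : K[X][X]) : polyToKxy p ∈ kxYRange K := ⟨polyToKxY p, rfl⟩

theorem kxToKxy_mem (c : Kx K) : kxToKxy c ∈ kxYRange K := ⟨C c, rfl⟩

theorem intDegree_kxYToKxy (p : (Kx K)[X]) : (kxYToKxy p).intDegree = p.natDegree :=
  RatFunc.intDegree_polynomial

theorem PreservesDegrees.mem (hσ : PreservesDegrees σ) {a : Kxy K} (ha : a ∈ kxYRange K) :
    σ a ∈ kxYRange K := by
  obtain ⟨p, rfl⟩ := ha
  obtain ⟨q, hq, -⟩ := hσ.exists_kxY p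
  exact ⟨q, hq.symm⟩

theorem PreservesDegrees.intDegree_map (hσ : PreservesDegrees σ) {a : Kxy K}
    (ha : a ∈ kxYRange K) : (σ a).intDegree = a.intDegree := by
  obtain ⟨p, rfl⟩ := ha
  obtain ⟨q, hq, hd⟩ := hσ.exists_kxY p
  rw [hq, intDegree_kxYToKxy, intDegree_kxYToKxy, Polynomial.natDegree_eq_of_degree_eq hd]

theorem PreservesDegrees.iterate_mem (hσ : PreservesDegrees σ) {a : Kxy K}
    (ha : a ∈ kxYRange K) (n : ℕ) : σ^[n] a ∈ kxYRange K := by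
  induction n with
  | zero => exact ha
  | succ n ih => rw [Function.iterate_succ_apply']; exact hσ.mem ih

theorem PreservesDegrees.facPow_mem (hσ : PreservesDegrees σ) {a : Kxy K}
    (ha : a ∈ kxYRange K) (n : ℕ) : facPow σ a n ∈ kxYRange K :=
  Subring.prod_mem _ fun j _ => hσ.iterate_mem ha j

theorem PreservesDegrees.intDegree_iterate (hσ : PreservesDegrees σ) {a : Kxy K}
    (ha : a ∈ kxYRange K) (n : ℕ) : (σ^[n] a).intDegree = a.intDegree := by
  induction n with
  | zero => rfl
  | succ n ih =>
    rw [Function.iterate_succ_apply', hσ.intDegree_map (hσ.iterate_mem ha n), ih]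

theorem PreservesDegrees.intDegree_facPow (hσ : PreservesDegrees σ) {a : Kxy K}
    (ha : a ∈ kxYRange K) (h0 : a ≠ 0) (n : ℕ) : (facPow σ a n).intDegree = n * a.intDegree := by
  induction n with
  | zero => simp [facPow_zero]
  | succ n ih =>
    rw [facPow_succ, RatFunc.intDegree_mul (facPow_ne_zero h0 n) (iterate_ne_zero h0 n), ih,
      hσ.intDegree_iterate ha]
    push_cast
    ring

/-- The element `a` has degree at most `d` in `y`. -/
def DegLE (a : Kxy K) (d : ℤ) : Prop := a = 0 ∨ a.intDegree ≤ d

theorem DegLE.mono {a : Kxy K} {d e : ℤ} (h : DegLE a d) (hde : d ≤ e) : DegLE a e :=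
  h.imp_right fun h => h.trans hde

theorem DegLE.add {a b : Kxy K} {d : ℤ} (ha : DegLE a d) (hb : DegLE b d) : DegLE (a + b) d := by
  by_cases hb0 : b = 0
  · simpa [hb0] using ha
  by_cases hab : a + b = 0
  · exact Or.inl hab
  rcases ha with rfl | ha
  · simpa using hb
  · exact Or.inr ((RatFunc.intDegree_add_le hb0 hab).trans (max_le ha (hb.resolve_left hb0)))

theorem DegLE.mul {a b : Kxy K} {d e : ℤ} (ha : DegLE a d) (hb : DegLE b e) :
    DegLE (a * b) (d + e) := by
  by_cases ha0 : a = 0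
  · exact Or.inl (by simp [ha0])
  by_cases hb0 : b = 0
  · exact Or.inl (by simp [hb0])
  refine Or.inr ?_
  rw [RatFunc.intDegree_mul ha0 hb0]
  exact add_le_add (ha.resolve_left ha0) (hb.resolve_left hb0)

theorem DegLE.neg {a : Kxy K} {d : ℤ} (h : DegLE a d) : DegLE (-a) d :=
  h.imp (fun h => by simp [h]) fun h => by rwa [RatFunc.intDegree_neg]

theorem DegLE.of_mul_left {a b : Kxy K} {d : ℤ} (ha : a ≠ 0) (h : DegLE (a * b) (a.intDegree + d)) :
    DegLE b d := by
  by_cases hb0 : b = 0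
  · exact Or.inl hb0
  have := h.resolve_left (mul_ne_zero ha hb0)
  rw [RatFunc.intDegree_mul ha hb0] at this
  exact Or.inr (by linarith)

theorem PreservesDegrees.degLE_map (hσ : PreservesDegrees σ) {a : Kxy K} {d : ℤ}
    (ha : a ∈ kxYRange K) (h : DegLE a d) : DegLE (σ a) d :=
  h.imp (fun h => by simp [h]) fun h => by rwa [hσ.intDegree_map ha]

/-- The Leibniz rule for a `σ`-derivation. -/
def SkewLeibniz (σ : Kxy K ≃+* Kxy K) (δ : Kxy K →ₗ[K] Kxy K) : Prop :=
  ∀ a b, δ (a * b) = δ a * b + σ a * δ b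

namespace SkewLeibniz

variable {δ : Kxy K →ₗ[K] Kxy K}

theorem map_one (hδ : SkewLeibniz σ δ) : δ 1 = 0 := by
  have := hδ 1 1
  simpa using this

theorem map_inv (hδ : SkewLeibniz σ δ) {a : Kxy K} (ha : a ≠ 0) :
    δ a⁻¹ * (a * σ a) = -δ a := by
  have h := hδ a a⁻¹
  rw [mul_inv_cancel₀ ha, hδ.map_one] at h
  have h' : δ a⁻¹ * (a * σ a) = a * (σ a * δ a⁻¹) := by ring
  rw [h', ← sub_eq_of_eq_add' h, zero_sub, mul_neg, mul_left_comm, mul_inv_cancel₀ ha, mul_one]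

/-- Applying $\delta$ to $1/a^{(n)}$ lengthens the denominator by one factor only, as $a^n$ becomes
$a^{n+1}$ under an ordinary derivative. The induction splits off the last factor of the factorial
power. -/
theorem map_inv_facPow (hδ : SkewLeibniz σ δ) {a : Kxy K} (ha : a ≠ 0) (n : ℕ) :
    δ (facPow σ a n)⁻¹ * facPow σ a (n + 1) = -∑ k ∈ Finset.range n, δ (σ^[k] a) := by
  induction n with
  | zero => simp [facPow_zero, hδ.map_one]
  | succ n ih =>
    have hF := facPow_ne_zero (σ := σ) ha n
    have hb := iterate_ne_zero (σ := σ) ha n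
    have hσb : σ (σ^[n] a) ≠ 0 := by simpa using hb
    have h2 : facPow σ a (n + 1 + 1) = facPow σ a n * (σ^[n] a * σ (σ^[n] a)) := by
      rw [facPow_succ, facPow_succ, Function.iterate_succ_apply', mul_assoc]
    have h3 : (facPow σ a (n + 1))⁻¹ = (σ^[n] a)⁻¹ * (facPow σ a n)⁻¹ := by
      rw [facPow_succ, mul_inv, mul_comm]
    rw [h3, hδ, h2, map_inv₀ σ, Finset.sum_range_succ, neg_add, ← ih, facPow_succ, ← hδ.map_inv hb]
    field_simp
    ring

end SkewLeibniz

theorem OreData.preservesDegrees_σx (D : OreData K) : PreservesDegrees D.σx := D.σx_poly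

theorem OreData.preservesDegrees_σy (D : OreData K) : PreservesDegrees D.σy := D.σy_poly

theorem OreData.skewLeibniz_δx (D : OreData K) : SkewLeibniz D.σx D.δx := D.δx_mul

theorem OreData.skewLeibniz_δy (D : OreData K) : SkewLeibniz D.σy D.δy := D.δy_mul

theorem OreData.δy_mul_kx (D : OreData K) (c : Kx K) (a : Kxy K) :
    D.δy (kxToKxy c * a) = D.σy (kxToKxy c) * D.δy a := by
  rw [D.δy_mul, D.δy_kx, zero_mul, zero_add]

theorem kxYToKxy_eq_inv_mul (p : (Kx K)[X]) : ∃ (s : K[X]) (P : K[X][X]), s ≠ 0 ∧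
    kxYToKxy p = (kxToKxy (algebraMap K[X] (Kx K) s))⁻¹ * polyToKxy P := by
  obtain ⟨s, P, hs, hP⟩ := exists_mul_eq_polyToKxY p
  have h2 : kxToKxy (algebraMap K[X] (Kx K) s) ≠ 0 := by simpa using hs
  refine ⟨s, P, hs, ?_⟩
  rw [polyToKxy_apply, ← hP, map_mul, kxYToKxy_C, inv_mul_cancel_left₀ h2]

/-- A denominator $s\in K[x]$ stays harmless: $\delta_x(1/s)=-\delta_x(s)/(s\,\sigma_x(s))$ again
has its denominator in $K(x)$. -/
theorem OreData.δx_mem (D : OreData K) {a : Kxy K} (ha : a ∈ kxYRange K) :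
    D.δx a ∈ kxYRange K := by
  obtain ⟨p, rfl⟩ := ha
  obtain ⟨s, P, hs, hP⟩ := kxYToKxy_eq_inv_mul p
  have h2 : kxToKxy (algebraMap K[X] (Kx K) s) ≠ 0 := by simpa using hs
  obtain ⟨q, hq, -⟩ := D.δx_poly P
  obtain ⟨s', hs', -⟩ := D.δx_poly (C s)
  obtain ⟨t, ht⟩ := D.preservesDegrees_σx.exists_kx (algebraMap K[X] (Kx K) s)
  have hσ2 : D.σx (kxToKxy (algebraMap K[X] (Kx K) s)) ≠ 0 := by simpa using h2
  have h3 := D.skewLeibniz_δx.map_inv h2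
  rw [← eq_div_iff (mul_ne_zero h2 hσ2), ← polyToKxy_C, hs', polyToKxy_C, ht,
    ← map_mul, div_eq_mul_inv, ← map_inv₀ kxToKxy (_ * t)] at h3
  rw [hP, D.δx_mul, h3, hq, map_inv₀ D.σx, ht, ← map_inv₀ kxToKxy t]
  exact add_mem (mul_mem (mul_mem (neg_mem (polyToKxy_mem _)) (kxToKxy_mem _)) (polyToKxy_mem _))
    (mul_mem (kxToKxy_mem _) (polyToKxy_mem _))

/-- Since $\delta_y$ vanishes on $K(x)$, a cleared denominator comes out as a factor from $K(x)$,
and the degree drop on $K[x,y]$ carries over. -/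
theorem OreData.exists_δy (D : OreData K) (p : (Kx K)[X]) :
    ∃ q : (Kx K)[X], D.δy (kxYToKxy p) = kxYToKxy q ∧ q.degree + 1 ≤ p.degree := by
  obtain ⟨s, P, hs, hP⟩ := exists_mul_eq_polyToKxY p
  have h1 : algebraMap K[X] (Kx K) s ≠ 0 := by simpa using hs
  obtain ⟨q, hq, -, hd⟩ := D.δy_poly P
  obtain ⟨t, ht⟩ := D.preservesDegrees_σy.exists_kx (algebraMap K[X] (Kx K) s)⁻¹
  have ht0 : t ≠ 0 := by
    rintro rfl
    rw [map_zero, map_eq_zero_iff _ D.σy.injective, map_eq_zero] at ht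
    exact inv_ne_zero h1 ht
  refine ⟨C t * polyToKxY q, ?_, ?_⟩
  · have hp : kxYToKxy p = kxToKxy (algebraMap K[X] (Kx K) s)⁻¹ * polyToKxy P := by
      rw [polyToKxy_apply, ← hP, ← kxYToKxy_C, ← map_mul, ← mul_assoc, ← map_mul,
        inv_mul_cancel₀ h1, Polynomial.C_1, one_mul]
    rw [hp, D.δy_mul_kx, ht, hq, map_mul, kxYToKxy_C, polyToKxy_apply]
  · rw [Polynomial.degree_C_mul ht0, degree_polyToKxY]
    refine hd.trans ?_
    rw [← degree_polyToKxY, ← hP, Polynomial.degree_C_mul h1]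

theorem OreData.δy_mem (D : OreData K) {a : Kxy K} (ha : a ∈ kxYRange K) :
    D.δy a ∈ kxYRange K := by
  obtain ⟨p, rfl⟩ := ha
  obtain ⟨q, hq, -⟩ := D.exists_δy p
  exact ⟨q, hq.symm⟩

theorem OreData.degLE_δy (D : OreData K) {a : Kxy K} {d : ℤ} (ha : a ∈ kxYRange K)
    (h : DegLE a d) : DegLE (D.δy a) (d - 1) := by
  obtain ⟨p, rfl⟩ := ha
  rcases h with h | h
  · exact Or.inl (by rw [h, map_zero])
  obtain ⟨q, hq, hd⟩ := D.exists_δy p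
  rw [hq]
  by_cases hq0 : q = 0
  · exact Or.inl (by rw [hq0, map_zero])
  have hp0 : p ≠ 0 := by
    rintro rfl
    rw [Polynomial.degree_zero, le_bot_iff, Polynomial.degree_eq_natDegree hq0] at hd
    exact absurd hd (by exact_mod_cast WithBot.coe_ne_bot)
  rw [Polynomial.degree_eq_natDegree hq0, Polynomial.degree_eq_natDegree hp0] at hd
  have hd' : q.natDegree + 1 ≤ p.natDegree := by exact_mod_cast hd
  rw [intDegree_kxYToKxy] at h
  refine Or.inr ?_
  rw [intDegree_kxYToKxy]
  omega

end FactorialPowers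

/-! ### Denominators that $\partial_y$ turns into a prescribed $G$. -/

section Denominators

variable {K : Type*} [Field K]

/-- The element `z` of `K(x)[y]` is such that `G` is a common denominator of `1/z`, `σ_y(1/z)`
and `δ_y(1/z)`, and `a` is the cofactor of `σ_y(z)` in `G`. -/
structure IsDenominator (D : OreData K) (G z a : Kxy K) : Prop where
  ne_zero : z ≠ 0
  mem : z ∈ kxYRange K
  cofactor_mem : a ∈ kxYRange K
  eq : G = a * D.σy z
  mul_inv_mem : G * z⁻¹ ∈ kxYRange K
  mul_δy_mem : G * D.δy z⁻¹ ∈ kxYRange K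

namespace IsDenominator

variable {D : OreData K}

theorem of_mem {c : Kxy K} (hc : c ∈ kxYRange K) : IsDenominator D c 1 c where
  ne_zero := one_ne_zero
  mem := one_mem _
  cofactor_mem := hc
  eq := by simp
  mul_inv_mem := by simpa using hc
  mul_δy_mem := by rw [inv_one, D.skewLeibniz_δy.map_one, mul_zero]; exact zero_mem _

theorem mul {G₁ z₁ a₁ G₂ z₂ a₂ : Kxy K} (h₁ : IsDenominator D G₁ z₁ a₁)
    (h₂ : IsDenominator D G₂ z₂ a₂) : IsDenominator D (G₁ * G₂) (z₁ * z₂) (a₁ * a₂) where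
  ne_zero := mul_ne_zero h₁.ne_zero h₂.ne_zero
  mem := mul_mem h₁.mem h₂.mem
  cofactor_mem := mul_mem h₁.cofactor_mem h₂.cofactor_mem
  eq := by rw [h₁.eq, h₂.eq, map_mul]; ring
  mul_inv_mem := by
    have : G₁ * G₂ * (z₁ * z₂)⁻¹ = (G₁ * z₁⁻¹) * (G₂ * z₂⁻¹) := by rw [mul_inv]; ring
    rw [this]
    exact mul_mem h₁.mul_inv_mem h₂.mul_inv_mem
  mul_δy_mem := by
    have hz : D.σy z₁ ≠ 0 := by simpa using h₁.ne_zero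
    -- The skew Leibniz rule produces $G_1\sigma_y(1/z_1)$, which is the cofactor $a_1$.
    have : G₁ * G₂ * D.δy (z₁ * z₂)⁻¹ =
        (G₁ * D.δy z₁⁻¹) * (G₂ * z₂⁻¹) + a₁ * (G₂ * D.δy z₂⁻¹) := by
      have h : G₁ * D.σy z₁⁻¹ = a₁ := by
        rw [h₁.eq, map_inv₀, mul_inv_cancel_right₀ hz]
      rw [mul_inv, D.δy_mul, ← h]
      ring
    rw [this]
    exact add_mem (mul_mem h₁.mul_δy_mem h₂.mul_inv_mem) (mul_mem h₁.cofactor_mem h₂.mul_δy_mem)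

theorem prod {m : ℕ} {G z a : Fin m → Kxy K} (h : ∀ i, IsDenominator D (G i) (z i) (a i)) :
    IsDenominator D (∏ i, G i) (∏ i, z i) (∏ i, a i) := by
  induction m with
  | zero => simpa using of_mem (one_mem (kxYRange K))
  | succ m ih =>
    rw [Fin.prod_univ_succ, Fin.prod_univ_succ, Fin.prod_univ_succ]
    exact (h 0).mul (ih fun i => h i.succ)

/-- Splitting $f^{(p)}=f^{(q)}\cdot(\sigma_y^q f)^{(p-q)}$ shows the second factor to be
$\sigma_y(z)$. The condition $q\ge1$ gives room for shifting back by one, and for the extra factor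
in the denominator of $\delta_y(1/z)$. -/
theorem facPow {f : Kxy K} (hf : f ∈ kxYRange K) (hf0 : f ≠ 0) {p q : ℕ} (hq : 1 ≤ q)
    (hqp : q ≤ p) : IsDenominator D (facPow D.σy f p) (facPow D.σy (D.σy^[q - 1] f) (p - q))
      (facPow D.σy f q) := by
  have hσ := D.preservesDegrees_σy
  obtain ⟨k, rfl⟩ := Nat.exists_eq_add_of_le' hq
  obtain ⟨m, rfl⟩ := Nat.exists_eq_add_of_le hqp
  have h1 : k + 1 - 1 = k := by omega
  have h2 : k + 1 + m - (k + 1) = m := by omega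
  rw [h1, h2]
  have hg := hσ.iterate_mem hf k
  have hg0 := iterate_ne_zero (σ := D.σy) hf0 k
  have hz := facPow_ne_zero (σ := D.σy) hg0 m
  have hG : _root_.facPow D.σy f (k + 1 + m) =
      _root_.facPow D.σy f k * _root_.facPow D.σy (D.σy^[k] f) (m + 1) :=
    facPow_congr_of_add_eq f (by omega)
  refine ⟨hz, hσ.facPow_mem hg m, hσ.facPow_mem hf _, ?_, ?_, ?_⟩
  · rw [facPow_add, map_facPow, Function.iterate_succ_apply']
  · rw [hG, facPow_succ (D.σy^[k] f), mul_assoc, mul_right_comm, mul_inv_cancel₀ hz, one_mul]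
    exact mul_mem (hσ.facPow_mem hf k) (hσ.iterate_mem hg m)
  · rw [hG, mul_assoc, mul_comm (_root_.facPow D.σy (D.σy^[k] f) (m + 1)),
      D.skewLeibniz_δy.map_inv_facPow hg0]
    exact mul_mem (hσ.facPow_mem hf k)
      (neg_mem (sum_mem fun j _ => D.δy_mem (hσ.iterate_mem hg j)))

/-- From $\delta_y(1/z)\,z\,\sigma_y(z)=-\delta_y(z)$ and $G=a\,\sigma_y(z)$ one gets $z\cdot
G\,\delta_y(1/z)=-\delta_y(z)\,a$. The degree drop of $\delta_y(z)$ then passes to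
$G\,\delta_y(1/z)$. -/
theorem degLE_mul_δy {G z a : Kxy K} {d : ℤ} (h : IsDenominator D G z a) (ha : DegLE a d) :
    DegLE (G * D.δy z⁻¹) (d - 1) := by
  apply DegLE.of_mul_left h.ne_zero
  have : z * (G * D.δy z⁻¹) = -(D.δy z * a) := by
    rw [h.eq, ← neg_mul, ← D.skewLeibniz_δy.map_inv h.ne_zero]
    ring
  rw [this]
  exact ((D.degLE_δy h.mem (Or.inr le_rfl)).mul ha).neg.mono (by linarith)

end IsDenominator

/-- A zeroth factorial power is $1$, so for $n=0$ every monic nonconstant polynomial would qualify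
and none would have largest degree. -/
theorem IsTopFactor.one_le {σ : Kxy K ≃+* Kxy K} {p q : (Kx K)[X]} {n : ℕ}
    (h : IsTopFactor σ p n q) : 1 ≤ n := by
  by_contra hn
  obtain rfl : n = 0 := by omega
  have := h.2.2 (X ^ (q.natDegree + 1)) ⟨Polynomial.monic_X_pow _, by
    rw [Polynomial.degree_X_pow]; exact_mod_cast Nat.succ_pos _, p, by simp [facPow_zero]⟩
  rw [Polynomial.natDegree_X_pow] at this
  omega

/-- This is the role of left borders: each split-off $q^{(n,y)}$ is treated with the shortest
cofactor $q^{(1,y)}=q$, and these cofactors multiply to the left border. -/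
theorem IsLeftBorder.exists_isDenominator {D : OreData K} {p l : (Kx K)[X]}
    (h : IsLeftBorder D.σy p l) :
    ∃ (z : Kxy K) (c : Kx K), IsDenominator D (kxYToKxy p) z (kxYToKxy (C c * l)) := by
  induction h with
  | const c hc =>
    refine ⟨1, c, ?_⟩
    rw [mul_one]
    exact IsDenominator.of_mem (kxYToKxy_mem _)
  | step p q s l n hq hs hl ih =>
    obtain ⟨z, c, hz⟩ := ih
    have hq0 : q ≠ 0 := hq.1.1.ne_zero
    have hq1 : kxYToKxy q ≠ 0 := fun h => hq0 (kxYToKxy_injective (by rw [h, map_zero]))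
    have hd := hz.mul (IsDenominator.facPow (D := D) (kxYToKxy_mem q) hq1 le_rfl hq.one_le)
    rw [← hs, facPow_one, ← map_mul, mul_assoc, mul_comm l q] at hd
    exact ⟨_, c, hd⟩

theorem degLE_polyToKxy (v : K[X][X]) : DegLE (polyToKxy v) v.natDegree := by
  right
  rw [polyToKxy_apply, intDegree_kxYToKxy,
    Polynomial.natDegree_eq_of_degree_eq (show (polyToKxY v).degree = v.degree from
      degree_polyToKxY v)]

/-- The denominators of elements of `A/I` for which the application of `∂_y` produces the
denominator `u^{(r, x)}`. -/
theorem exists_antiderivative_denominator (D : OreData K) {u v : K[X][X]} (hv : v ≠ 0)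
    {η : ℕ} (hη : η ∈ etaSet D.σx D.σy u v) {r : ℕ} (hr : 1 ≤ r) :
    ∃ w l : Kxy K, w ≠ 0 ∧ l ∈ kxYRange K ∧ DegLE l η ∧
      facPow D.σx (polyToKxy u) r * D.σy w = polyToKxy v * l ∧
      facPow D.σx (polyToKxy u) r * D.δy w ∈ kxYRange K ∧
      DegLE (facPow D.σx (polyToKxy u) r * D.δy w) (η + (v.natDegree - 1)) := by
  obtain ⟨m, f, g, h, p, q, hpq, hvf, huf, l, hl, hlη⟩ := hη r hr
  have hσ := D.preservesDegrees_σy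
  obtain ⟨z₀, c, hz₀⟩ := hl.exists_isDenominator
  have hv' := polyToKxy_ne_zero hv
  rw [hvf] at hv'
  have hh : polyToKxy h ≠ 0 := by simpa using left_ne_zero_of_mul hv'
  have hσh : D.σy (polyToKxy h) ≠ 0 := left_ne_zero_of_mul hv'
  have hf : ∀ i, polyToKxy (f i) ≠ 0 := by
    intro i hi
    refine Finset.prod_ne_zero_iff.mp (right_ne_zero_of_mul hv') i (Finset.mem_univ _) ?_
    obtain ⟨k, hk⟩ := Nat.exists_eq_add_of_le' (hpq i).2
    rw [hk, facPow_succ', hi, zero_mul]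
  -- Treat $g$ through its left border and each $f_i^{(p_i,y)}$ with cofactor $f_i^{(q_i,y)}$. The
  -- total cofactor of $G=u^{(r,x)}$ is then a multiple of $a=\prod_i f_i^{(q_i,y)}$, the part of
  -- $v$ beside $\sigma_y(h)$.
  have hd := hz₀.mul (IsDenominator.prod fun i => IsDenominator.facPow (D := D)
    (polyToKxy_mem (f i)) (hf i) (hpq i).2 (hpq i).1)
  rw [← polyToKxy_apply, ← huf] at hd
  set a := ∏ i, facPow D.σy (polyToKxy (f i)) (q i)
  set z := z₀ * ∏ i, facPow D.σy (D.σy^[q i - 1] (polyToKxy (f i))) (p i - q i)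
  set G := facPow D.σx (polyToKxy u) r
  have ha0 : a ≠ 0 := right_ne_zero_of_mul hv'
  have hzσ : D.σy z ≠ 0 := by simpa using hd.ne_zero
  have hGz : G * D.σy z⁻¹ = kxYToKxy (C c * l) * a := by
    rw [map_inv₀, hd.eq, mul_inv_cancel_right₀ hzσ]
  have hldeg : DegLE (kxYToKxy (C c * l)) η := by
    right
    rw [intDegree_kxYToKxy]
    have := Polynomial.natDegree_C_mul_le c l
    exact_mod_cast this.trans hlη
  have hdega := hldeg.mul (Or.inr le_rfl : DegLE a a.intDegree)
  have hdeg : (polyToKxy h).intDegree + a.intDegree ≤ v.natDegree := by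
    have := (degLE_polyToKxy v).resolve_left (polyToKxy_ne_zero hv)
    rwa [hvf, RatFunc.intDegree_mul hσh ha0, hσ.intDegree_map (polyToKxy_mem h)] at this
  have hδ : G * D.δy (polyToKxy h * z⁻¹) =
      D.δy (polyToKxy h) * (kxYToKxy (C c * l) * a) + polyToKxy h * (G * D.δy z⁻¹) := by
    rw [mul_comm (polyToKxy h), D.δy_mul, ← hGz]
    ring
  -- With $w=h/z$, the factor $\sigma_y(h)$ completes the cofactor to a multiple of $v$, and the
  -- degree bound uses $\deg_y\sigma_y(h)=\deg_y h$.
  refine ⟨polyToKxy h * z⁻¹, kxYToKxy (C c * l), mul_ne_zero hh (inv_ne_zero hd.ne_zero),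
    kxYToKxy_mem _, hldeg, ?_, ?_, ?_⟩
  · rw [map_mul, mul_left_comm, hGz, hvf]
    ring
  · rw [hδ]
    exact add_mem (mul_mem (D.δy_mem (polyToKxy_mem h)) hd.cofactor_mem)
      (mul_mem (polyToKxy_mem h) hd.mul_δy_mem)
  · rw [hδ]
    refine DegLE.add
      (((D.degLE_δy (polyToKxy_mem h) (Or.inr le_rfl)).mul hdega).mono (by linarith)) ?_
    exact (DegLE.mul (Or.inr le_rfl) (hd.degLE_mul_δy hdega)).mono (by linarith)

end Denominators

/-! ### Existence of left borders and of $\eta$. -/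

section LeftBorders

variable {K : Type*} [Field K] {σ : Kxy K ≃+* Kxy K}

theorem kxYToKxy_ne_zero {p : (Kx K)[X]} (hp : p ≠ 0) : kxYToKxy p ≠ 0 :=
  fun h => hp (kxYToKxy_injective (by rw [h, map_zero]))

theorem PreservesDegrees.natDegree_eq_of_facPow_dvd (hσ : PreservesDegrees σ)
    {p q s : (Kx K)[X]} {n : ℕ} (hp : p ≠ 0) (hq : q ≠ 0)
    (h : kxYToKxy p = kxYToKxy s * facPow σ (kxYToKxy q) n) :
    s ≠ 0 ∧ p.natDegree = s.natDegree + n * q.natDegree := by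
  have hs : s ≠ 0 := by
    rintro rfl
    rw [map_zero, zero_mul] at h
    exact kxYToKxy_ne_zero hp h
  refine ⟨hs, ?_⟩
  have h' := congrArg RatFunc.intDegree h
  rw [RatFunc.intDegree_mul (kxYToKxy_ne_zero hs) (facPow_ne_zero (kxYToKxy_ne_zero hq) n),
    hσ.intDegree_facPow (kxYToKxy_mem q) (kxYToKxy_ne_zero hq), intDegree_kxYToKxy,
    intDegree_kxYToKxy, intDegree_kxYToKxy] at h'
  exact_mod_cast h'

theorem Nat.exists_max_of_bounded {P : ℕ → Prop} (h : ∃ n, P n) {B : ℕ} (hB : ∀ n, P n → n ≤ B) :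
    ∃ n, P n ∧ ∀ m, P m → m ≤ n :=
  ⟨sSup {n | P n}, Nat.sSup_mem h ⟨B, hB⟩, fun _ hm => le_csSup ⟨B, hB⟩ hm⟩

/-- Both maxima exist because $n\deg_y q\le\deg_y p$. The normalization of $p$ itself is a candidate
with $n=1$. -/
theorem PreservesDegrees.exists_isTopFactor (hσ : PreservesDegrees σ) {p : (Kx K)[X]}
    (hp : 0 < p.natDegree) : ∃ n q, IsTopFactor σ p n q := by
  have hp0 : p ≠ 0 := by rintro rfl; simp at hp
  have hlc : p.leadingCoeff ≠ 0 := by simpa using hp0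
  have hdeg : ∀ n q, IsFacFactor σ p n q → n * q.natDegree ≤ p.natDegree ∧ 0 < q.natDegree := by
    rintro n q ⟨hm, hd, s, hs⟩
    obtain ⟨-, h⟩ := hσ.natDegree_eq_of_facPow_dvd hp0 hm.ne_zero hs
    exact ⟨by omega, Polynomial.natDegree_pos_iff_degree_pos.mpr hd⟩
  have h1 : IsFacFactor σ p 1 (p * C p.leadingCoeff⁻¹) := by
    refine ⟨Polynomial.monic_mul_leadingCoeff_inv hp0, ?_, C p.leadingCoeff, ?_⟩
    · rw [Polynomial.degree_mul_leadingCoeff_inv p hp0]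
      exact Polynomial.natDegree_pos_iff_degree_pos.mp hp
    · rw [facPow_one, ← map_mul, mul_left_comm, ← Polynomial.C_mul, mul_inv_cancel₀ hlc,
        Polynomial.C_1, mul_one]
  obtain ⟨n, ⟨q₀, hq₀⟩, hn⟩ := Nat.exists_max_of_bounded
    (P := fun n => ∃ q, IsFacFactor σ p n q) ⟨1, _, h1⟩ (B := p.natDegree) (by
      rintro n ⟨q, hq⟩
      obtain ⟨h2, h3⟩ := hdeg n q hq
      exact (Nat.le_mul_of_pos_right n h3).trans h2)
  have hn1 : 1 ≤ n := hn 1 ⟨_, h1⟩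
  obtain ⟨d, ⟨q, hq, rfl⟩, hd⟩ := Nat.exists_max_of_bounded
    (P := fun d => ∃ q, IsFacFactor σ p n q ∧ q.natDegree = d) ⟨_, q₀, hq₀, rfl⟩
    (B := p.natDegree) (by
      rintro d ⟨q, hq, rfl⟩
      exact (Nat.le_mul_of_pos_left _ hn1).trans (hdeg n q hq).1)
  exact ⟨n, q, hq, fun m q' hq' => hn m ⟨q', hq'⟩, fun q' hq' => hd _ ⟨q', hq', rfl⟩⟩

/-- Every nonzero element of `K(x)[y]` has a left border. -/
theorem PreservesDegrees.exists_isLeftBorder (hσ : PreservesDegrees σ) {p : (Kx K)[X]}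
    (hp : p ≠ 0) : ∃ l, IsLeftBorder σ p l := by
  induction hN : p.natDegree using Nat.strong_induction_on generalizing p with
  | _ N ih =>
    rcases Nat.eq_zero_or_pos p.natDegree with h0 | hpos
    · rw [Polynomial.eq_C_of_natDegree_eq_zero h0] at hp ⊢
      exact ⟨1, IsLeftBorder.const _ (by simpa using hp)⟩
    · obtain ⟨n, q, hq⟩ := hσ.exists_isTopFactor hpos
      obtain ⟨s, hs⟩ := hq.1.2.2
      obtain ⟨hs0, hdeg⟩ := hσ.natDegree_eq_of_facPow_dvd hp hq.1.1.ne_zero hs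
      have hq1 : 0 < q.natDegree := Polynomial.natDegree_pos_iff_degree_pos.mpr hq.1.2.1
      have := Nat.mul_pos hq.one_le hq1
      obtain ⟨l, hl⟩ := ih s.natDegree (by omega) hs0 rfl
      exact ⟨_, IsLeftBorder.step p q s l n hq hs hl⟩

theorem PreservesDegrees.exists_facPow_eq (hσ : PreservesDegrees σ) (u : K[X][X]) (r : ℕ) :
    ∃ g : K[X][X], facPow σ (polyToKxy u) r = polyToKxy g := by
  have key : ∀ j : ℕ, ∃ g : K[X][X], σ^[j] (polyToKxy u) = polyToKxy g := by
    intro j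
    induction j with
    | zero => exact ⟨u, rfl⟩
    | succ j ih =>
      obtain ⟨g, hg⟩ := ih
      obtain ⟨q, hq, -⟩ := hσ g
      exact ⟨q, by rw [Function.iterate_succ_apply', hg, hq]⟩
  choose g hg using key
  exact ⟨∏ j ∈ Finset.range r, g j, by rw [map_prod]; exact Finset.prod_congr rfl fun j _ => hg j⟩

theorem etaSet_nonempty {σx σy : Kxy K ≃+* Kxy K} (hx : PreservesDegrees σx)
    (hy : PreservesDegrees σy) {u : K[X][X]} (hu : u ≠ 0) (huy : IsYProper σx σy u)
    (v : K[X][X]) : (etaSet σx σy u v).Nonempty := by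
  obtain ⟨d, hd⟩ := huy
  obtain ⟨r₀, hr₀⟩ := Filter.eventually_atTop.mp hd
  obtain ⟨h, hh⟩ := hy.poly_surjective v
  choose g hg using hx.exists_facPow_eq u
  have hg0 : ∀ r, polyToKxY (g r) ≠ 0 := by
    intro r h0
    refine facPow_ne_zero (σ := σx) (polyToKxy_ne_zero hu) r ?_
    rw [hg, polyToKxy_apply, h0, map_zero]
  choose l hl using fun r => hy.exists_isLeftBorder (hg0 r)
  -- Use no factors $f_i$ at all: $g=u^{(r,x)}$ and $v=\sigma_y(h)$, where $h$ exists by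
  -- `poly_surjective`. Properness bounds the borders for $r\ge r_0$, and the finitely many smaller
  -- $r$ are absorbed into the maximum.
  refine ⟨max d ((Finset.range r₀).sup fun r => (l r).natDegree), fun r _ =>
    ⟨0, Fin.elim0, g r, h, Fin.elim0, Fin.elim0, fun i => i.elim0, by simp [hh], by simp [hg], ?_⟩⟩
  by_cases hr : r < r₀
  · exact ⟨l r, hl r, le_max_of_le_right
      (Finset.le_sup (f := fun r => (l r).natDegree) (Finset.mem_range.mpr hr))⟩
  · obtain ⟨P, hP, l', hl', hd'⟩ := hr₀ r (not_lt.mp hr)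
    have : P = polyToKxY (g r) := kxYToKxy_injective (by rw [hP, hg, polyToKxy_apply])
    exact ⟨l', this ▸ hl', hd'.trans (le_max_left _ _)⟩

theorem natDegree_sub_one_le_maxDegY {n : ℕ} (v : K[X][X]) (V : Matrix (Fin n) (Fin n) K[X][X]) :
    (v.natDegree : ℤ) - 1 ≤ maxDegY v V :=
  (Finset.le_fold_max _).mpr (Or.inl le_rfl)

theorem degLE_maxDegY {n : ℕ} (v : K[X][X]) (V : Matrix (Fin n) (Fin n) K[X][X]) (i j : Fin n) :
    DegLE (polyToKxy (V i j)) (maxDegY v V) := by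
  classical
  by_cases h : V i j = 0
  · exact Or.inl (by rw [h, map_zero])
  · refine (degLE_polyToKxy _).mono ((Finset.le_fold_max _).mpr (Or.inr ⟨(i, j), ?_, le_rfl⟩))
    simpa using h

end LeftBorders

/-! ### The height is attained. -/

section Heights

variable {K : Type*} [Field K] {D : OreData K} {I : Ideal (OreAlgebra D)}

theorem exists_isMulMatrix {n : ℕ} (b : Module.Basis (Fin n) (Kxy K) (OreAlgebra D ⧸ I))
    (d : OreAlgebra D) : ∃ v V, IsMulMatrix b d v V := by
  obtain ⟨v, hv, h⟩ := exists_common_denominator (Finset.univ : Finset (Fin n × Fin n))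
    fun ij => b.repr (d • b ij.1) ij.2
  choose V hV using fun i j => h (i, j) (Finset.mem_univ _)
  refine ⟨v, Matrix.of V, hv, fun i => ?_⟩
  conv_lhs => rw [← b.sum_repr (d • b i)]
  refine Finset.sum_congr rfl fun j _ => ?_
  rw [Matrix.of_apply, ← hV, mul_div_cancel_right₀ _ (polyToKxy_ne_zero hv)]

theorem heightSet_nonempty (hI : IsProperDFinite I) : (heightSet I).Nonempty := by
  obtain ⟨-, n, b, u, U, hb, hU, hu⟩ := hI
  obtain ⟨v, V, hV⟩ := exists_isMulMatrix b (OreAlgebra.dy D)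
  have hη := Nat.sInf_mem
    (etaSet_nonempty D.preservesDegrees_σx D.preservesDegrees_σy hU.1 hu v)
  exact ⟨_, n, b, u, v, U, V, _, hb, hU, hV, hu, ⟨hη, fun m hm => Nat.sInf_le hm⟩, rfl⟩

/-- The height of a proper ideal is attained. -/
theorem height_mem (hI : IsProperDFinite I) : height I ∈ heightSet I := by
  -- The bound $-1$ comes from $\eta\ge0$ and $\deg_y v-1\ge-1$.
  refine Int.csInf_mem (heightSet_nonempty hI) ⟨-1, ?_⟩
  rintro ρ ⟨n, b, u, v, U, V, η, -, -, -, -, -, rfl⟩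
  have := natDegree_sub_one_le_maxDegY v V
  omega

end Heights

/-! ### Coordinates with respect to an admissible basis. -/

section Coordinates

variable {K : Type*} [Field K] {D : OreData K} {I : Ideal (OreAlgebra D)}

theorem OreAlgebra.dx_smul_smul (a : Kxy K) (W : OreAlgebra D ⧸ I) :
    dx D • (a • W) = D.σx a • (dx D • W) + D.δx a • W := by
  obtain ⟨P, rfl⟩ := Submodule.Quotient.mk_surjective I W
  exact congrArg (Submodule.Quotient.mk (p := I)) (dx_mul_smul a P)

theorem OreAlgebra.dy_smul_smul (a : Kxy K) (W : OreAlgebra D ⧸ I) :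
    dy D • (a • W) = D.σy a • (dy D • W) + D.δy a • W := by
  obtain ⟨P, rfl⟩ := Submodule.Quotient.mk_surjective I W
  exact congrArg (Submodule.Quotient.mk (p := I)) (dy_mul_smul a P)

theorem IsMulMatrix.repr_smul {n : ℕ} {b : Module.Basis (Fin n) (Kxy K) (OreAlgebra D ⧸ I)}
    {d : OreAlgebra D} {u : K[X][X]} {U : Matrix (Fin n) (Fin n) K[X][X]}
    (hU : IsMulMatrix b d u U) {σ δ : Kxy K → Kxy K}
    (hd : ∀ (a : Kxy K) (W : OreAlgebra D ⧸ I), d • (a • W) = σ a • (d • W) + δ a • W)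
    (W : OreAlgebra D ⧸ I) (k : Fin n) :
    b.repr (d • W) k =
      ∑ j, σ (b.repr W j) * (polyToKxy (U j k) / polyToKxy u) + δ (b.repr W k) := by
  classical
  conv_lhs => rw [← b.sum_repr W, Finset.smul_sum]
  simp only [hd, hU.2, map_sum, map_add, map_smul, Module.Basis.repr_self, Finset.sum_add_distrib,
    Finsupp.coe_add, Finsupp.coe_smul, Finsupp.coe_finsetSum, Pi.add_apply, Finset.sum_apply,
    Pi.smul_apply, smul_eq_mul, Finsupp.single_apply]
  simp

/-- Admissibility is the case $i=0$. Each further $\partial_x$ moves the denominator $u^{(i,x)}$ to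
$\sigma_x(u^{(i,x)})$ and adds a factor $u$, giving $u^{(i+1,x)}$. By `map_inv_facPow` the
$\delta_x$-term needs no larger denominator. -/
theorem facPow_mul_repr_dx_pow_mem {n : ℕ}
    {b : Module.Basis (Fin n) (Kxy K) (OreAlgebra D ⧸ I)} (hb : IsAdmissible b)
    {u : K[X][X]} {U : Matrix (Fin n) (Fin n) K[X][X]}
    (hU : IsMulMatrix b (OreAlgebra.dx D) u U) (i : ℕ) (k : Fin n) :
    facPow D.σx (polyToKxy u) i *
      b.repr (OreAlgebra.dx D ^ i • (Submodule.Quotient.mk 1 : OreAlgebra D ⧸ I)) k ∈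
        kxYRange K := by
  induction i generalizing k with
  | zero =>
    rw [facPow_zero, one_mul, pow_zero, one_smul]
    exact hb k
  | succ i ih =>
    have hσ := D.preservesDegrees_σx
    have hu := polyToKxy_ne_zero hU.1
    have hF := facPow_ne_zero (σ := D.σx) hu i
    have hσF : D.σx (facPow D.σx (polyToKxy u) i) ≠ 0 := by simpa using hF
    have hD := D.skewLeibniz_δx.map_inv_facPow hu i
    rw [pow_succ', mul_smul, hU.repr_smul OreAlgebra.dx_smul_smul, mul_add, Finset.mul_sum]
    set r := b.repr (OreAlgebra.dx D ^ i • (Submodule.Quotient.mk 1 : OreAlgebra D ⧸ I))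
    refine add_mem (sum_mem fun j _ => ?_) ?_
    · have : facPow D.σx (polyToKxy u) (i + 1) *
          (D.σx (r j) * (polyToKxy (U j k) / polyToKxy u)) =
          D.σx (facPow D.σx (polyToKxy u) i * r j) * polyToKxy (U j k) := by
        rw [facPow_succ', map_mul]
        field_simp
      rw [this]
      exact mul_mem (hσ.mem (ih j)) (polyToKxy_mem _)
    · set F := facPow D.σx (polyToKxy u) i
      have hr : r k = F⁻¹ * (F * r k) := by rw [inv_mul_cancel_left₀ hF]
      have hδr : facPow D.σx (polyToKxy u) (i + 1) * D.δx (r k) =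
          D.δx F⁻¹ * facPow D.σx (polyToKxy u) (i + 1) * (F * r k) +
            polyToKxy u * D.δx (F * r k) := by
        have hF' : facPow D.σx (polyToKxy u) (i + 1) * D.σx F⁻¹ = polyToKxy u := by
          rw [facPow_succ', map_inv₀ D.σx, mul_inv_cancel_right₀ hσF]
        conv_lhs => rw [hr, D.δx_mul, mul_add, ← mul_assoc _ (D.σx F⁻¹), hF', ← mul_assoc]
        rw [mul_comm (D.δx F⁻¹)]
      rw [hδr, hD]
      refine add_mem (mul_mem (neg_mem (sum_mem fun j _ => ?_)) (ih k))
        (mul_mem (polyToKxy_mem _) (D.δx_mem (ih k)))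
      exact D.δx_mem (hσ.iterate_mem (polyToKxy_mem u) j)

/-- In the matrix term $G\sigma_y(w)=vl$ cancels the denominator $v$, leaving
$\sigma_y(c)\,l\,V_{jk}$. The diagonal term is $G\delta_y(w)\,c+vl\,\delta_y(c)$. The two account
for $\deg_y V$ and $\deg_y v-1$ in the height. -/
theorem mul_repr_dy_mem_and_degLE {n : ℕ}
    {b : Module.Basis (Fin n) (Kxy K) (OreAlgebra D ⧸ I)}
    {v : K[X][X]} {V : Matrix (Fin n) (Fin n) K[X][X]}
    (hV : IsMulMatrix b (OreAlgebra.dy D) v V) {G w l : Kxy K} {η : ℕ}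
    (hl : l ∈ kxYRange K) (hlη : DegLE l η) (hG : G * D.σy w = polyToKxy v * l)
    (hδ : G * D.δy w ∈ kxYRange K) (hδη : DegLE (G * D.δy w) (η + (v.natDegree - 1)))
    {c : Kxy K} {s : ℤ} (hc : c ∈ kxYRange K) (hcs : DegLE c s) (j k : Fin n) :
    G * b.repr (OreAlgebra.dy D • ((c * w) • b j)) k ∈ kxYRange K ∧
      DegLE (G * b.repr (OreAlgebra.dy D • ((c * w) • b j)) k) (s + (η + maxDegY v V)) := by
  have hσ := D.preservesDegrees_σy
  have hv := polyToKxy_ne_zero hV.1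
  have hmax := natDegree_sub_one_le_maxDegY v V
  rw [hV.repr_smul OreAlgebra.dy_smul_smul, mul_add]
  have h1 : G * ∑ i, D.σy (b.repr ((c * w) • b j) i) * (polyToKxy (V i k) / polyToKxy v) =
      D.σy c * (l * polyToKxy (V j k)) := by
    rw [Finset.sum_eq_single j]
    · rw [map_smul, Module.Basis.repr_self, Finsupp.smul_single, Finsupp.single_eq_same,
        smul_eq_mul, mul_one, map_mul]
      have : G * (D.σy c * D.σy w * (polyToKxy (V j k) / polyToKxy v)) =
          D.σy c * (G * D.σy w) * (polyToKxy (V j k) / polyToKxy v) := by ring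
      rw [this, hG]
      field_simp
    · intro i _ hi
      rw [map_smul, Module.Basis.repr_self, Finsupp.smul_single, Finsupp.single_eq_of_ne hi,
        map_zero, zero_mul]
    · simp
  have h2 : ∃ e : Kxy K, G * D.δy (b.repr ((c * w) • b j) k) = e ∧ e ∈ kxYRange K ∧
      DegLE e (s + (η + maxDegY v V)) := by
    refine ⟨_, rfl, ?_⟩
    rw [map_smul, Module.Basis.repr_self, Finsupp.smul_single, smul_eq_mul, mul_one]
    by_cases hjk : k = j
    · subst hjk
      have : G * D.δy (c * w) = G * D.δy w * c + polyToKxy v * l * D.δy c := by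
        rw [mul_comm c w, D.δy_mul, ← hG]
        ring
      rw [Finsupp.single_eq_same, this]
      refine ⟨add_mem (mul_mem hδ hc) (mul_mem (mul_mem (polyToKxy_mem v) hl) (D.δy_mem hc)),
        DegLE.add ((hδη.mul hcs).mono (by linarith)) ?_⟩
      exact (((degLE_polyToKxy v).mul hlη).mul (D.degLE_δy hc hcs)).mono (by linarith)
    · rw [Finsupp.single_eq_of_ne hjk, map_zero, mul_zero]
      exact ⟨zero_mem _, Or.inl rfl⟩
  obtain ⟨e, he, hem, hed⟩ := h2
  rw [h1, he]
  refine ⟨add_mem (mul_mem (hσ.mem hc) (mul_mem hl (polyToKxy_mem _))) hem, DegLE.add ?_ hed⟩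
  exact (hσ.degLE_map hc hcs).mul (hlη.mul (degLE_maxDegY v V j k))

theorem kx_smul_def (c : Kx K) (W : OreAlgebra D ⧸ I) : c • W = kxToKxy c • W := rfl

theorem kxYToKxy_sum_C_mul_X_pow {S : ℕ} (d : Fin S → Kx K) :
    kxYToKxy (∑ i, C (d i) * X ^ (i : ℕ)) = ∑ i, kxToKxy (d i) * kxYToKxy X ^ (i : ℕ) := by
  simp only [map_sum, map_mul, map_pow, kxYToKxy_C]

/-- Elements of `A/I` with common denominator `G` and numerators of bounded degree lie in a
finite-dimensional `K(x)`-space. -/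
theorem mem_span_of_degLE {n : ℕ} (b : Module.Basis (Fin n) (Kxy K) (OreAlgebra D ⧸ I))
    {G : Kxy K} (hG : G ≠ 0) {N : ℕ} {W : OreAlgebra D ⧸ I}
    (hW : ∀ k, G * b.repr W k ∈ kxYRange K ∧ DegLE (G * b.repr W k) N) :
    W ∈ Submodule.span (Kx K) (Set.range fun p : Fin n × Fin (N + 1) =>
      (G⁻¹ * kxYToKxy X ^ (p.2 : ℕ)) • b p.1) := by
  rw [← b.sum_repr W]
  refine Submodule.sum_mem _ fun k _ => ?_
  obtain ⟨⟨p, hp⟩, hd⟩ := hW k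
  have hdeg : p.natDegree < N + 1 := by
    rcases hd with hd | hd
    · rw [hd] at hp
      rw [kxYToKxy_injective (hp.trans (map_zero _).symm), Polynomial.natDegree_zero]
      exact Nat.succ_pos N
    · rw [← hp, intDegree_kxYToKxy] at hd
      omega
  have h1 : b.repr W k • b k =
      ∑ i : Fin (N + 1), p.coeff i • ((G⁻¹ * kxYToKxy X ^ (i : ℕ)) • b k) := by
    have h2 : b.repr W k =
        ∑ i : Fin (N + 1), kxToKxy (p.coeff i) * (G⁻¹ * kxYToKxy X ^ (i : ℕ)) := by
      rw [← inv_mul_cancel_left₀ hG (b.repr W k), ← hp]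
      conv_lhs => rw [p.as_sum_range_C_mul_X_pow' hdeg, ← Fin.sum_univ_eq_sum_range
        (fun i => C (p.coeff i) * X ^ i), kxYToKxy_sum_C_mul_X_pow fun i : Fin (N + 1) =>
          p.coeff i, Finset.mul_sum]
      exact Finset.sum_congr rfl fun i _ => mul_left_comm _ _ _
    rw [h2, Finset.sum_smul]
    exact Finset.sum_congr rfl fun i _ => by rw [kx_smul_def, mul_smul]
  rw [h1]
  exact Submodule.sum_mem _ fun i _ => Submodule.smul_mem _ _
    (Submodule.subset_span ⟨(k, i), rfl⟩)

theorem eq_zero_of_sum_kx_smul_eq_zero {n S : ℕ}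
    (b : Module.Basis (Fin n) (Kxy K) (OreAlgebra D ⧸ I)) {w : Kxy K} (hw : w ≠ 0)
    {d : Fin n × Fin S → Kx K}
    (h : ∑ p, kxToKxy (d p) • ((kxYToKxy X ^ (p.2 : ℕ) * w) • b p.1) = 0) : d = 0 := by
  rw [Fintype.sum_prod_type] at h
  have h1 : ∑ j, ((∑ i : Fin S, kxToKxy (d (j, i)) * kxYToKxy X ^ (i : ℕ)) * w) • b j = 0 := by
    rw [← h]
    refine Finset.sum_congr rfl fun j _ => ?_
    rw [Finset.sum_mul, Finset.sum_smul]
    exact Finset.sum_congr rfl fun i _ => by rw [mul_assoc, mul_smul]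
  funext ⟨j, i⟩
  have h2 := Fintype.linearIndependent_iff.mp b.linearIndependent _ h1 j
  have h3 := (mul_eq_zero.mp h2).resolve_right hw
  rw [← kxYToKxy_sum_C_mul_X_pow, map_eq_zero_iff _ kxYToKxy_injective] at h3
  have h4 := congrArg (fun p => Polynomial.coeff p (i : ℕ)) h3
  simpa [Polynomial.finsetSum_coeff, Polynomial.coeff_X_pow, Fin.val_inj] using h4

end Coordinates

/-! ### The dimension count. -/

section Counting

variable {K : Type*} [Field K] {D : OreData K} {I : Ideal (OreAlgebra D)}

theorem finrank_le_finrank_ker_add {F M ι κ : Type*} [Field F] [AddCommGroup M] [Module F M]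
    [Fintype ι] [Fintype κ] (L : (ι → F) →ₗ[F] M) (e : κ → M)
    (h : ∀ x, L x ∈ Submodule.span F (Set.range e)) :
    Fintype.card ι ≤ Fintype.card κ + Module.finrank F (LinearMap.ker L) := by
  have h1 := L.finrank_range_add_finrank_ker
  rw [Module.finrank_fintype_fun_eq_card] at h1
  have h2 : LinearMap.range L ≤ Submodule.span F (Set.range e) := by
    rintro _ ⟨x, rfl⟩
    exact h x
  have : Module.Finite F (Submodule.span F (Set.range e)) :=
    FiniteDimensional.span_of_finite F (Set.finite_range e)
  have h3 := (Submodule.finrank_mono h2).trans (finrank_range_le_card e)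
  omega

theorem sum_kx_smul_mem_span {R M ι κ : Type*} [Ring R] [AddCommGroup M] [Module R M] [Fintype ι]
    [Fintype κ] {a : ι → M} {e : κ → M} {N : Submodule R M} (ha : ∀ i, a i ∈ N)
    (he : ∀ p, e p ∈ N) (x : ι ⊕ κ → R) : Fintype.linearCombination R (Sum.elim a e) x ∈ N := by
  rw [Fintype.linearCombination_apply]
  refine Submodule.sum_mem _ fun p _ => Submodule.smul_mem _ _ ?_
  cases p with
  | inl i => exact ha i
  | inr p => exact he p

/-- If no nonzero combination of the `a i` is in the image of `∂_y`, then the relations between the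
elements `a i` and `∂_y e` with `e = y^k w b_j` are bounded in number by the dimension of the kernel
of `∂_y`. -/
theorem finrank_ker_le_of_forall_eq_zero {n S r : ℕ}
    (b : Module.Basis (Fin n) (Kxy K) (OreAlgebra D ⧸ I)) {w : Kxy K} (hw : w ≠ 0) {φ : ℕ}
    (hφ : Module.rank (Kx K) (dyKernel I) = φ) (a : Fin r → OreAlgebra D ⧸ I)
    (ha : ∀ (t : Fin r → Kx K) (W : OreAlgebra D ⧸ I),
      ∑ i, t i • a i = OreAlgebra.dy D • W → t = 0) :
    Module.finrank (Kx K) (LinearMap.ker (Fintype.linearCombination (Kx K) (Sum.elim a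
      fun p : Fin n × Fin S =>
        OreAlgebra.dy D • ((kxYToKxy X ^ (p.2 : ℕ) * w) • b p.1)))) ≤ φ := by
  set e : Fin n × Fin S → OreAlgebra D ⧸ I := fun p => (kxYToKxy X ^ (p.2 : ℕ) * w) • b p.1
  set L := Fintype.linearCombination (Kx K) (Sum.elim a fun p => OreAlgebra.dy D • e p) with hL
  have hσ := D.preservesDegrees_σy
  choose τ hτ using hσ.exists_kx
  choose τ' hτ' using hσ.kx_surjective
  have hsymm : ∀ c, D.σy.symm (kxToKxy c) = kxToKxy (τ' c) := fun c => by
    rw [← hτ', RingEquiv.symm_apply_apply]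
  -- Moving a coefficient $c\in K(x)$ inside $\partial_y$ replaces it by $\sigma_y^{-1}(c)$, so that
  -- $\partial_yJ(x)=\sum_p x_p\,\partial_y e_p$. This makes $J$ additive but only semilinear.
  let J : (Fin r ⊕ Fin n × Fin S → Kx K) →+ OreAlgebra D ⧸ I :=
    { toFun := fun x => ∑ p, D.σy.symm (kxToKxy (x (Sum.inr p))) • e p
      map_zero' := by simp
      map_add' := fun x y => by simp [add_smul, Finset.sum_add_distrib] }
  have hJ : ∀ x, J x = ∑ p, D.σy.symm (kxToKxy (x (Sum.inr p))) • e p := fun _ => rfl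
  have hJdy : ∀ x, OreAlgebra.dy D • J x = ∑ p, x (Sum.inr p) • (OreAlgebra.dy D • e p) := by
    intro x
    rw [hJ, Finset.smul_sum]
    refine Finset.sum_congr rfl fun p _ => ?_
    rw [OreAlgebra.dy_smul_smul, RingEquiv.apply_symm_apply, hsymm, D.δy_kx, zero_smul, add_zero]
    rfl
  have hLx : ∀ x, L x = ∑ i, x (Sum.inl i) • a i + OreAlgebra.dy D • J x := by
    intro x
    rw [hL, Fintype.linearCombination_apply, Fintype.sum_sum_type, hJdy]
    rfl
  have hker : ∀ x ∈ LinearMap.ker L, (∀ i, x (Sum.inl i) = 0) ∧ OreAlgebra.dy D • J x = 0 := by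
    intro x hx
    rw [LinearMap.mem_ker, hLx] at hx
    have h0 : (fun i => x (Sum.inl i)) = 0 := ha _ (-J x)
      (by rw [smul_neg, eq_neg_iff_add_eq_zero.mpr hx])
    have h1 : ∀ i, x (Sum.inl i) = 0 := fun i => congrFun h0 i
    refine ⟨h1, ?_⟩
    rwa [Finset.sum_eq_zero fun i _ => by rw [h1, zero_smul], zero_add] at hx
  let J' : LinearMap.ker L →+ dyKernel I :=
    { toFun := fun x => ⟨J (x : Fin r ⊕ Fin n × Fin S → Kx K), (hker x x.2).2⟩
      map_zero' := Subtype.ext (map_zero J)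
      map_add' := fun x y => Subtype.ext (map_add J x.1 y.1) }
  have hinj : Function.Injective J' := by
    rw [injective_iff_map_eq_zero]
    intro x hx
    have hx' : J (x : Fin r ⊕ Fin n × Fin S → Kx K) = 0 := congrArg Subtype.val hx
    rw [hJ] at hx'
    simp only [hsymm] at hx'
    have h0 := eq_zero_of_sum_kx_smul_eq_zero b hw hx'
    have h1 : ∀ p, (x : Fin r ⊕ Fin n × Fin S → Kx K) (Sum.inr p) = 0 := by
      intro p
      have h2 : τ' ((x : Fin r ⊕ Fin n × Fin S → Kx K) (Sum.inr p)) = 0 := congrFun h0 p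
      have h3 := hτ' ((x : Fin r ⊕ Fin n × Fin S → Kx K) (Sum.inr p))
      rw [h2, map_zero, map_zero, eq_comm, map_eq_zero] at h3
      exact h3
    ext p
    cases p with
    | inl i => exact (hker x x.2).1 i
    | inr p => exact h1 p
  -- The restriction of $J$ to the relations satisfies $J(\tau(c)x)=c\,J(x)$ with
  -- $\tau=\sigma_y|_{K(x)}$. Such an injective semilinear map still gives the comparison of ranks.
  have hrank := rank_le_of_injective_injective (R := Kx K) (R' := Kx K) τ J' (fun c hc => by
      have := hτ c
      rwa [hc, map_zero, map_eq_zero_iff _ D.σy.injective, map_eq_zero] at this) hinj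
    (fun c x => Subtype.ext (by
      change J (τ c • (x : Fin r ⊕ Fin n × Fin S → Kx K)) = kxToKxy c • J x
      rw [hJ, hJ, Finset.smul_sum]
      refine Finset.sum_congr rfl fun p _ => ?_
      rw [Pi.smul_apply, smul_eq_mul, map_mul, map_mul, ← hτ, RingEquiv.symm_apply_apply,
        mul_smul]))
  rw [hφ, ← Module.finrank_eq_rank] at hrank
  exact_mod_cast hrank

theorem exists_degree_bound {ι : Type*} [Fintype ι] (a : ι → Kxy K) (B : ℤ) :
    ∃ N : ℕ, B ≤ N ∧ ∀ i, DegLE (a i) N := by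
  refine ⟨max B.toNat (Finset.univ.sup fun i => (a i).intDegree.toNat), ?_, fun i => Or.inr ?_⟩
  · exact (Int.self_le_toNat B).trans (by exact_mod_cast le_max_left _ _)
  · refine (Int.self_le_toNat _).trans ?_
    exact_mod_cast le_max_of_le_right
      (Finset.le_sup (f := fun i => (a i).intDegree.toNat) (Finset.mem_univ i))

theorem exists_combination_eq_dy_smul (hI : IsProperDFinite I) {φ : ℕ}
    (hφ : Module.rank (Kx K) (dyKernel I) = φ) {r : ℕ}
    (hr : (Module.finrank (Kxy K) (OreAlgebra D ⧸ I) : ℤ) * height I + φ < r) :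
    ∃ t : Fin r → Kx K, t ≠ 0 ∧ ∃ W : OreAlgebra D ⧸ I,
      ∑ i, t i • (OreAlgebra.dx D ^ (i : ℕ) • (Submodule.Quotient.mk 1 : OreAlgebra D ⧸ I)) =
        OreAlgebra.dy D • W := by
  obtain ⟨n, b, u, v, U, V, η, hb, hU, hV, -, hη, hρ⟩ := height_mem hI
  have hn : Module.finrank (Kxy K) (OreAlgebra D ⧸ I) = n := by
    rw [Module.finrank_eq_card_basis b, Fintype.card_fin]
  rw [hn] at hr
  by_contra! hcon
  -- The exponent $r+1$ is larger than the $r$ powers of $\partial_x$ require; it ensures an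
  -- exponent $\ge1$, as `etaSet` demands, also for $r=0$.
  obtain ⟨w, l, hw, hl, hlη, hG, hδ, hδη⟩ :=
    exists_antiderivative_denominator D hV.1 hη.1 (Nat.succ_pos r)
  have hx := D.preservesDegrees_σx
  have hu := polyToKxy_ne_zero hU.1
  set G := facPow D.σx (polyToKxy u) (r + 1)
  have hG0 : G ≠ 0 := facPow_ne_zero hu _
  set a : Fin r → OreAlgebra D ⧸ I := fun i => OreAlgebra.dx D ^ (i : ℕ) • Submodule.Quotient.mk 1
  have hamem : ∀ i k, G * b.repr (a i) k ∈ kxYRange K := by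
    intro i k
    have h1 : G = facPow D.σx (polyToKxy u) i *
        facPow D.σx (D.σx^[i] (polyToKxy u)) (r + 1 - i) := facPow_congr_of_add_eq _ (by omega)
    rw [h1, mul_right_comm]
    exact mul_mem (facPow_mul_repr_dx_pow_mem hb hU i k)
      (hx.facPow_mem (hx.iterate_mem (polyToKxy_mem u) _) _)
  obtain ⟨N, hBN, hN⟩ := exists_degree_bound
    (fun ik : Fin r × Fin n => G * b.repr (a ik.1) ik.2) (height I)
  -- The largest exponent $k=S-1=N-\varrho$ makes the degree bound $k+\varrho$ equal to $N$. Since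
  -- $N\ge\varrho$, this $S$ is a natural number.
  obtain ⟨S, hS⟩ : ∃ S : ℕ, (S : ℤ) = N + 1 - height I :=
    ⟨_, Int.toNat_of_nonneg (by omega)⟩
  have hker := finrank_ker_le_of_forall_eq_zero (S := S) b hw hφ a
    fun t W h => by_contra fun h0 => hcon t h0 W h
  have hspan := finrank_le_finrank_ker_add (Fintype.linearCombination (Kx K) (Sum.elim a
      fun p : Fin n × Fin S => OreAlgebra.dy D • ((kxYToKxy X ^ (p.2 : ℕ) * w) • b p.1)))
    (fun p : Fin n × Fin (N + 1) => (G⁻¹ * kxYToKxy X ^ (p.2 : ℕ)) • b p.1) (fun x => by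
      refine sum_kx_smul_mem_span (fun i => ?_) (fun p => ?_) x
      · exact mem_span_of_degLE b hG0 fun k => ⟨hamem i k, hN (i, k)⟩
      · refine mem_span_of_degLE b hG0 fun k => ?_
        have hdeg : DegLE (kxYToKxy X ^ (p.2 : ℕ) : Kxy K) (p.2 : ℕ) := by
          right
          rw [← map_pow, intDegree_kxYToKxy, Polynomial.natDegree_X_pow]
        have h2 := mul_repr_dy_mem_and_degLE hV hl hlη hG hδ hδη
          (pow_mem (kxYToKxy_mem X) (p.2 : ℕ)) hdeg p.1 k
        refine ⟨h2.1, h2.2.mono ?_⟩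
        rw [← hρ]
        have := p.2.2
        omega)
  rw [Fintype.card_sum, Fintype.card_prod, Fintype.card_prod, Fintype.card_fin, Fintype.card_fin,
    Fintype.card_fin, Fintype.card_fin] at hspan
  have h3 : r + n * S ≤ n * (N + 1) + φ := hspan.trans (Nat.add_le_add_left hker _)
  zify at h3
  rw [hS] at h3
  linarith

end Counting

/-! ### From coefficient vectors to operators. -/

section Telescoper

variable {K : Type*} [Field K] {D : OreData K}

/-- The operator `∑ t_i ∂_x^i`. -/
noncomputable def xOperator (D : OreData K) {r : ℕ} (t : Fin r → Kx K) : OreAlgebra D :=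
  ∑ i : Fin r, t i • OreAlgebra.dx D ^ (i : ℕ)

theorem xOperator_eq {r : ℕ} (t : Fin r → Kx K) :
    xOperator D t = ∑ i : Fin r, OreAlgebra.mono D ((i : ℕ), 0) (kxToKxy (t i)) := by
  refine Finset.sum_congr rfl fun i _ => ?_
  rw [OreAlgebra.mono_eq, pow_zero, mul_one, smul_mul_assoc, one_mul]
  rfl

theorem coeff_xOperator {r : ℕ} (t : Fin r → Kx K) (k j : ℕ) :
    (xOperator D t).coeff k j =
      ∑ i : Fin r, if (i : ℕ) = k ∧ j = 0 then kxToKxy (t i) else 0 := by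
  rw [xOperator_eq]
  let f : OreAlgebra D →+ Kxy K := Finsupp.applyAddHom (k, j)
  change f _ = _
  rw [map_sum]
  refine Finset.sum_congr rfl fun i _ => ?_
  change (Finsupp.single ((i : ℕ), 0) (kxToKxy (t i)) : ℕ × ℕ →₀ Kxy K) (k, j) = _
  rw [Finsupp.single_apply]
  simp [Prod.ext_iff, eq_comm]

theorem xOperator_mem {r : ℕ} (t : Fin r → Kx K) :
    xOperator D t ∈ OreAlgebra.xOperators D := by
  refine ⟨fun k => ?_, fun k j hj => ?_⟩
  · rw [coeff_xOperator]
    refine ⟨∑ i : Fin r, if (i : ℕ) = k then t i else 0, ?_⟩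
    rw [map_sum]
    refine Finset.sum_congr rfl fun i _ => ?_
    split_ifs <;> simp_all
  · rw [coeff_xOperator]
    simp [hj]

theorem xOperator_ne_zero {r : ℕ} {t : Fin r → Kx K} (ht : t ≠ 0) : xOperator D t ≠ 0 := by
  intro h
  apply ht
  funext i
  have h1 := coeff_xOperator (D := D) t i 0
  rw [h] at h1
  simp only [and_true, Fin.val_inj, Finset.sum_ite_eq', Finset.mem_univ, if_true] at h1
  exact (map_eq_zero _).mp h1.symm

theorem ordX_xOperator_le {r : ℕ} (t : Fin (r + 1) → Kx K) : (xOperator D t).ordX ≤ r := by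
  refine Finset.sup_le fun ⟨k, j⟩ hkj => ?_
  by_contra hk
  refine Finsupp.mem_support_iff.mp hkj ?_
  change (xOperator D t).coeff k j = 0
  rw [coeff_xOperator]
  refine Finset.sum_eq_zero fun i _ => if_neg fun h => hk ?_
  change k ≤ r
  omega

end Telescoper

theorem mainTheorem1 {K : Type*} [Field K] [CharZero K] (D : OreData K)
    (I : Ideal (OreAlgebra D)) (hI : IsProperDFinite I)
    (φ : ℕ) (hφ : Module.rank (Kx K) (dyKernel I) = φ) :
    ∃ T : OreAlgebra D, T ∈ OreAlgebra.xOperators D ∧ T ≠ 0 ∧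
      ∃ C : OreAlgebra D, T - OreAlgebra.dy D * C ∈ I ∧
        (T.ordX : ℤ) ≤ (Module.finrank (Kxy K) (OreAlgebra D ⧸ I) : ℤ) * height I + φ := by
  set B : ℤ := (Module.finrank (Kxy K) (OreAlgebra D ⧸ I) : ℤ) * height I + φ with hB
  -- The height may be negative. If the bound were negative, the count with $r=0$ would give a
  -- nonzero vector of length $0$.
  have hB0 : 0 ≤ B := by
    by_contra hneg
    obtain ⟨t, ht, -⟩ := exists_combination_eq_dy_smul hI hφ (r := 0)
      (by push_cast; omega)
    exact ht (Subsingleton.elim _ _)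
  obtain ⟨r, hr⟩ := Int.eq_ofNat_of_zero_le hB0
  -- Taking $B+1$ coefficients exceeds the bound just enough, and the resulting operator has order
  -- at most $B$.
  obtain ⟨t, ht, W, hW⟩ := exists_combination_eq_dy_smul hI hφ (r := r + 1)
    (by push_cast; omega)
  obtain ⟨C, rfl⟩ := Submodule.Quotient.mk_surjective I W
  refine ⟨xOperator D t, xOperator_mem t, xOperator_ne_zero ht, C, ?_, ?_⟩
  · rw [← Submodule.Quotient.eq, ← smul_eq_mul (OreAlgebra.dy D) C, Submodule.Quotient.mk_smul,
      ← hW]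
    change I.mkQ (∑ i, _) = _
    rw [map_sum]
    refine Finset.sum_congr rfl fun i _ => ?_
    rw [← Submodule.Quotient.mk_smul, smul_eq_mul, mul_one]
    rfl
  · rw [hr]
    exact_mod_cast ordX_xOperator_le t
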